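/- Let $M\subset\mathbb{R}^N$ be an oriented $m$-dimensional smooth submanifold with Gauss map $\mathfrak T$, that is, $\mathfrak T(x)=\tau_1\wedge\dots\wedge\tau_m$ for a positively oriented orthonormal frame $\tau_1,\dots,\tau_m$ of $T_xM$; we regard $\mathfrak T$ as a multivector field with values in the geometric (Clifford) algebra of $\mathbb{R}^N$ with $v^2=v\cdot v$. For multivectors put $\langle A,B\rangle=\langle A B^{\mathbf t}\rangle_0$, where $\langle\cdot\rangle_0$ is the scalar part and $B^{\mathbf t}$ the reversion of $B$. Write $D_a$ for the directional derivative along $M$ in the direction $a\in T_xM$, $P$ for the orthogonal projection onto $T_xM$, $\mathrm B(a,b)=(D_a b)^\perp$ (for tangent vector fields $a,b$) for the second fundamental form, $$\vec H=\sum_{j}\mathrm B(\tau_j,\tau_j),\qquad |\mathrm B|^2=\sum_{j,l}\sum_\alpha\big(n_\alpha\cdot \mathrm B(\tau_l,\tau_j)\big)^2$$ for the mean curvature vector and the squared norm of $\mathrm B$, where $(n_\alpha)$ is an orthonormal frame of the normal space. For $a\in T_xM$ let $$\mathcal S(a)=\sum_j\tau_j\,(D_{\tau_j}P)(a)\quad\text{(geometric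 product)},\qquad \mathcal S_a=\sum_j\tau_j\wedge (D_{\tau_j}P)(a),$$ and write $$\partial_a\langle \mathcal S_a\mathfrak T,I\rangle=\sum_j\tau_j\,\langle \mathcal S_{\tau_j}\mathfrak T,I\rangle,\qquad \mathcal S(\partial_a)\wedge\mathcal S_a=\sum_j \mathcal S(\tau_j)\wedge\mathcal S_{\tau_j}.$$ Let $\Delta_M$ be the Laplace–Beltrami operator of $M$. Suppose that the mean curvature vector field is curl-free, i.e. $\partial\wedge\vec H:=\sum_j\tau_j\wedge D_{\tau_j}\vec H=0$ on $M$, and that for some fixed unit $m$-blade $I$ (a simple $m$-vector with $\langle I,I\rangle=1$) one has $\langle\mathfrak T(x),I\rangle>0$ for all $x\in M$. Then $\ln\langle\mathfrak T,I\rangle$ is smooth on $M$, and on $M$ $$-\Delta_M\ln\langle\mathfrak T,I\rangle=|\mathrm B|^2+\frac{|\partial_a\langle \mathcal S_a\mathfrak T,I\rangle|^2-\big\langle(\mathcal S(\partial_a)\wedge\mathcal S_a)\mathfrak T,I\big\rangle\,\langle\mathfrak T,I\rangle}{\langle\mathfrak T,I\rangle^2}.$$ -/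

import Mathlib

open scoped ContDiff

namespace GeomCalc

/-! ### Geometric algebra of `ℝᴺ` -/

/-- Euclidean space `ℝᴺ`. -/
abbrev Euc (N : ℕ) : Type := EuclideanSpace ℝ (Fin N)

/-- The quadratic form `v ↦ v · v` of Euclidean space. -/
noncomputable abbrev euclQ (N : ℕ) : QuadraticForm ℝ (Euc N) :=
  LinearMap.BilinMap.toQuadraticMap (innerₗ (Euc N))

/-- The geometric algebra of `ℝᴺ` with the geometric (Clifford) product, so that `v * v = v · v`
for vectors. Its elements are the multivectors; the exterior algebra is identified with it through
the linear isomorphism `CliffordAlgebra.equivExterior`. -/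
abbrev GA (N : ℕ) : Type := CliffordAlgebra (euclQ N)

variable {N : ℕ}

/-- A vector regarded as a multivector. -/
noncomputable def vec (v : Euc N) : GA N := CliffordAlgebra.ι (euclQ N) v

/-- The exterior product of multivectors. -/
noncomputable def wedge (A B : GA N) : GA N :=
  (CliffordAlgebra.equivExterior (euclQ N)).symm
    (CliffordAlgebra.equivExterior (euclQ N) A * CliffordAlgebra.equivExterior (euclQ N) B)

/-- The exterior product `v₁ ∧ … ∧ vₘ` of vectors. -/
noncomputable def blade {m : ℕ} (v : Fin m → Euc N) : GA N :=
  (CliffordAlgebra.equivExterior (euclQ N)).symm (ExteriorAlgebra.ιMulti ℝ m v)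

/-- The scalar (grade zero) part of a multivector. -/
noncomputable def scalarPart (A : GA N) : ℝ :=
  ExteriorAlgebra.algebraMapInv (CliffordAlgebra.equivExterior (euclQ N) A)

/-- The inner product `⟨A, B⟩ = A ∗ Bᵗ` of multivectors, where `A ∗ B` is the scalar part of the
geometric product `A B` and `ᵗ` is the reversion. -/
noncomputable def ip (A B : GA N) : ℝ := scalarPart (A * CliffordAlgebra.reverse B)

/-- The unit `m`-blades: simple `m`-vectors of norm one. -/
def unitBlades (N m : ℕ) : Set (GA N) :=
  {A | (∃ v : Fin m → Euc N, A = blade v) ∧ ip A A = 1}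

/-- The scalar part of the geometric product of two vectors is their Euclidean product, the rest
is their exterior product. -/
theorem vec_mul_vec (a b : Euc N) :
    vec a * vec b = algebraMap ℝ (GA N) (inner ℝ a b) + wedge (vec a) (vec b) := by
  apply (CliffordAlgebra.equivExterior (euclQ N)).injective
  have h : QuadraticMap.associated (R := ℝ) (euclQ N) a b = inner ℝ a b := by
    rw [euclQ, LinearMap.BilinMap.toQuadraticMap, QuadraticMap.associated_apply]
    have := norm_add_sq_real a b
    simp
    linarith
  have h1 : ∀ v, CliffordAlgebra.equivExterior (euclQ N) (vec v) = ExteriorAlgebra.ι ℝ v :=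
    fun v => CliffordAlgebra.changeForm_ι CliffordAlgebra.changeForm.associated_neg_proof v
  rw [map_add, wedge, LinearEquiv.apply_symm_apply, h1, h1]
  refine (CliffordAlgebra.changeForm_ι_mul_ι CliffordAlgebra.changeForm.associated_neg_proof a b).trans ?_
  have h2 : CliffordAlgebra.equivExterior (euclQ N) (algebraMap ℝ (GA N) (inner ℝ a b)) =
      algebraMap ℝ _ (inner ℝ a b) := CliffordAlgebra.changeForm_algebraMap CliffordAlgebra.changeForm.associated_neg_proof _
  rw [h2, ← h, add_comm, sub_eq_add_neg, ← map_neg]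
  simp

/-! ### Submanifolds and their Gauss map -/

/-- `M` is an `m`-dimensional smooth (embedded) submanifold of `ℝᴺ`: near each of its points a
smooth diffeomorphism between open subsets of `ℝᴺ` straightens `M` to an `m`-dimensional linear
subspace. -/
def IsSmoothSubmanifold (m : ℕ) (M : Set (Euc N)) : Prop :=
  ∀ x ∈ M, ∃ (Φ : OpenPartialHomeomorph (Euc N) (Euc N)) (L : Submodule ℝ (Euc N)),
    x ∈ Φ.source ∧ ContDiffOn ℝ ∞ Φ Φ.source ∧ ContDiffOn ℝ ∞ Φ.symm Φ.target ∧
    Module.finrank ℝ L = m ∧ ∀ y ∈ Φ.source, Φ y ∈ L ↔ y ∈ M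

/-- The tangent space `T_x M`, spanned by the velocities at `x` of curves that run in `M`. -/
def tangentSpace (M : Set (Euc N)) (x : Euc N) : Submodule ℝ (Euc N) :=
  Submodule.span ℝ {v | ∃ c : ℝ → Euc N, (∀ t, c t ∈ M) ∧ c 0 = x ∧ HasDerivAt c v 0}

/-- An orthonormal frame `τ₁, …, τₘ` of `T_x M`. None of the sums below depends on its choice. -/
noncomputable def tau (M : Set (Euc N)) (x : Euc N)
    (j : Fin (Module.finrank ℝ (tangentSpace M x))) : Euc N :=
  (stdOrthonormalBasis ℝ (tangentSpace M x) j : Euc N)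

/-- An orthonormal frame `n₁, …, n_k` of the normal space `N_x M`. -/
noncomputable def nu (M : Set (Euc N)) (x : Euc N)
    (α : Fin (Module.finrank ℝ (tangentSpace M x)ᗮ)) : Euc N :=
  (stdOrthonormalBasis ℝ (tangentSpace M x)ᗮ α : Euc N)

/-- The orthogonal projection `P` of `ℝᴺ` onto `T_x M`. -/
noncomputable def proj (M : Set (Euc N)) (x v : Euc N) : Euc N :=
  (tangentSpace M x).starProjection v

/-- `T` is the Gauss map of `M` with an orientation: a continuous `m`-vector field on `M` such that
`T x = τ₁ ∧ … ∧ τₘ` for an orthonormal basis of `T_x M`. (On the finite-dimensional space of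
multivectors continuity means continuity of all components `⟨T, J⟩`.) -/
def IsGaussMap (m : ℕ) (M : Set (Euc N)) (T : Euc N → GA N) : Prop :=
  (∀ x ∈ M, ∃ τ : OrthonormalBasis (Fin m) ℝ (tangentSpace M x),
    T x = blade (fun j => (τ j : Euc N))) ∧
  ∀ J : GA N, ContinuousOn (fun x => ip (T x) J) M

/-! ### Differentiation on a submanifold -/

section Derivative

variable {F : Type*} [NormedAddCommGroup F] [NormedSpace ℝ F]

/-- The directional derivative `(a · ∂) f` at `x` of a function `f` on `M`, for `a ∈ T_x M`. Only
the values of `f` on `M` matter. -/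
noncomputable def dirDeriv (M : Set (Euc N)) (f : Euc N → F) (x a : Euc N) : F :=
  fderivWithin ℝ f M x a

/-- The directional derivative is the derivative along any curve in `M` with velocity `a`. -/
theorem hasDerivAt_comp_curve {M : Set (Euc N)} {f : Euc N → F} {x a : Euc N} {c : ℝ → Euc N}
    (hf : DifferentiableWithinAt ℝ f M x) (hcM : ∀ t, c t ∈ M) (hc0 : c 0 = x)
    (hc : HasDerivAt c a 0) : HasDerivAt (fun t => f (c t)) (dirDeriv M f x a) 0 := by
  have h := hf.hasFDerivWithinAt
  rw [← hc0] at h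
  have := h.comp_hasDerivAt 0 hc (Filter.Eventually.of_forall hcM)
  rw [← hc0]
  exact this

end Derivative

/-- The gradient `∂φ = ∑ⱼ τⱼ (τⱼ · ∂)φ` on `M` of a scalar function. -/
noncomputable def grad (M : Set (Euc N)) (φ : Euc N → ℝ) (x : Euc N) : Euc N :=
  ∑ j, dirDeriv M φ x (tau M x j) • tau M x j

/-- The divergence `∂ · X = ∑ⱼ τⱼ · ((τⱼ · ∂) X)` on `M` of a vector field. -/
noncomputable def divergence (M : Set (Euc N)) (X : Euc N → Euc N) (x : Euc N) : ℝ :=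
  ∑ j, inner ℝ (tau M x j) (dirDeriv M X x (tau M x j))

/-- The curl `∂ ∧ X = ∑ⱼ τⱼ ∧ ((τⱼ · ∂) X)` on `M` of a vector field. -/
noncomputable def curl (M : Set (Euc N)) (X : Euc N → Euc N) (x : Euc N) : GA N :=
  ∑ j, wedge (vec (tau M x j)) (vec (dirDeriv M X x (tau M x j)))

/-- The Laplace–Beltrami operator `Δ_M φ = div grad φ`. -/
noncomputable def laplaceBeltrami (M : Set (Euc N)) (φ : Euc N → ℝ) (x : Euc N) : ℝ :=
  divergence M (grad M φ) x

/-! ### Second fundamental form and shape -/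

/-- The second fundamental form `B(a, b) = ((a · ∂) b)^⊥` for `a, b ∈ T_x M`, where `b` is
extended to the tangent vector field `y ↦ P_y b`. -/
noncomputable def secondFF (M : Set (Euc N)) (x a b : Euc N) : Euc N :=
  (tangentSpace M x)ᗮ.starProjection (dirDeriv M (fun y => proj M y b) x a)

/-- The mean curvature vector: the trace of the second fundamental form. -/
noncomputable def meanCurv (M : Set (Euc N)) (x : Euc N) : Euc N :=
  ∑ j, secondFF M x (tau M x j) (tau M x j)

/-- The squared norm `|B|² = ∑ (h_{αjl})²`, `h_{αjl} = n_α · B(τ_l, τ_j)`, of the second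
fundamental form. -/
noncomputable def normSqB (M : Set (Euc N)) (x : Euc N) : ℝ :=
  ∑ j, ∑ l, ∑ α, (inner ℝ (nu M x α) (secondFF M x (tau M x l) (tau M x j))) ^ 2

/-- The shape operator `S(a) = ∑ⱼ τⱼ ((τⱼ · ∂)P)(a)` (geometric product) of a vector `a`. -/
noncomputable def shape (M : Set (Euc N)) (x a : Euc N) : GA N :=
  ∑ j, vec (tau M x j) * vec (dirDeriv M (fun y => proj M y a) x (tau M x j))

/-- The shape bivector `S_a = ∑ⱼ τⱼ ∧ ((τⱼ · ∂)P)(a)` of a vector `a`. -/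
noncomputable def shapeBiv (M : Set (Euc N)) (x a : Euc N) : GA N :=
  ∑ j, wedge (vec (tau M x j)) (vec (dirDeriv M (fun y => proj M y a) x (tau M x j)))

/-- `∂_a f(a) = ∑ⱼ τⱼ f(τⱼ)` for a scalar function `f` of `a ∈ T_x M` that is linear. -/
noncomputable def derivTangent (M : Set (Euc N)) (x : Euc N) (f : Euc N → ℝ) : Euc N :=
  ∑ j, f (tau M x j) • tau M x j

/-- The multivector `S(∂_a) ∧ S_a = ∑ⱼ S(τⱼ) ∧ S_{τⱼ}`. -/
noncomputable def shapeWedge (M : Set (Euc N)) (x : Euc N) : GA N :=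
  ∑ j, wedge (shape M x (tau M x j)) (shapeBiv M x (tau M x j))

end GeomCalc

namespace GeomCalc

variable {N : ℕ}

/-! ### Products of vectors and blades -/

/-! Near a point of $M$ a smooth orthonormal tangent frame extends to an open subset of
$\mathbb{R}^N$. Its projection field $P$ extends with it, so derivatives along $M$ become ordinary
derivatives of $P$ in tangent directions. Differentiating $P^2=P$ shows that $D_aP$ maps tangent
vectors to normal ones and normal vectors to tangent ones. On tangent vectors $(D_aP)(b)=\mathrm
B(a,b)$, which is symmetric.

Differentiating the frame blade replaces each $\tau_j$ by $D_a\tau_j$. Only the normal part $\mathrm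
B(a,\tau_j)$ survives, and it acts as a bivector factor: $D_a\mathfrak T=-\mathcal S_a\mathfrak T$
(`exists_hasFDerivAt_frameBlade`). Hence, with $w=\langle\mathfrak T,I\rangle$, the gradient of $\ln
w$ is $-w^{-1}\sum_j\langle\mathcal S_{\tau_j}\mathfrak T,I\rangle\tau_j$.

Its divergence has three contributions. Differentiating $1/w$ gives the squared gradient term.
Differentiating $\mathcal S$ gives, by Codazzi, the curl of $\vec H$, which vanishes
(`sum_wedge_codazzi`). Differentiating $\mathfrak T$ gives $\sum_j\mathcal S_{\tau_j}^2$, and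
Clifford multiplication splits this into $\mathcal S(\partial_a)\wedge\mathcal S_a-|\mathrm B|^2$
(`sum_vec_mul_vec_sq`, `sum_ip_shapeL_sq`).

The local blade equals $\mathfrak T$ up to sign. Neither $\ln|w|$ nor the right-hand side notices
the sign. -/

open CliffordAlgebra in
theorem equivExterior_vec (v : Euc N) :
    equivExterior (euclQ N) (vec v) = ExteriorAlgebra.ι ℝ v :=
  changeForm_ι changeForm.associated_neg_proof v

theorem equivExterior_algebraMap (r : ℝ) :
    CliffordAlgebra.equivExterior (euclQ N) (algebraMap ℝ (GA N) r) = algebraMap ℝ _ r :=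
  CliffordAlgebra.changeForm_algebraMap CliffordAlgebra.changeForm.associated_neg_proof r

theorem associated_euclQ (a b : Euc N) :
    QuadraticMap.associated (R := ℝ) (euclQ N) a b = inner ℝ a b := by
  rw [euclQ, LinearMap.BilinMap.toQuadraticMap, QuadraticMap.associated_apply]
  have := norm_add_sq_real a b
  simp
  linarith

/-- The geometric product with a vector is the sum of the exterior product and the contraction. -/
theorem equivExterior_vec_mul (a : Euc N) (X : GA N) :
    CliffordAlgebra.equivExterior (euclQ N) (vec a * X) =
      ExteriorAlgebra.ι ℝ a * CliffordAlgebra.equivExterior (euclQ N) X +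
        CliffordAlgebra.contractLeft (Q := (0 : QuadraticForm ℝ (Euc N))) (innerₗ (Euc N) a)
          (CliffordAlgebra.equivExterior (euclQ N) X) := by
  have h : QuadraticMap.associated (R := ℝ) (-euclQ N) a = -innerₗ (Euc N) a := by
    ext b
    rw [map_neg, LinearMap.neg_apply, LinearMap.neg_apply, LinearMap.neg_apply,
      associated_euclQ, innerₗ_apply_apply]
  have h' : ∀ d : Module.Dual ℝ (Euc N), d = -innerₗ (Euc N) a → ∀ A Y : ExteriorAlgebra ℝ (Euc N),
      A - CliffordAlgebra.contractLeft (Q := (0 : QuadraticForm ℝ (Euc N))) d Y =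
        A + CliffordAlgebra.contractLeft (Q := (0 : QuadraticForm ℝ (Euc N)))
          (innerₗ (Euc N) a) Y := by
    rintro d rfl A Y
    rw [map_neg, LinearMap.neg_apply, sub_neg_eq_add]
  exact (CliffordAlgebra.changeForm_ι_mul
    CliffordAlgebra.changeForm.associated_neg_proof a X).trans (h' _ h _ _)

theorem equivExterior_wedge (A B : GA N) :
    CliffordAlgebra.equivExterior (euclQ N) (wedge A B) =
      CliffordAlgebra.equivExterior (euclQ N) A * CliffordAlgebra.equivExterior (euclQ N) B := by
  rw [wedge, LinearEquiv.apply_symm_apply]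

/-- The exterior product as a bilinear map. -/
noncomputable def wedgeₗ (N : ℕ) : GA N →ₗ[ℝ] GA N →ₗ[ℝ] GA N :=
  LinearMap.mk₂ ℝ wedge
    (fun A B C => by simp only [wedge, map_add, add_mul])
    (fun c A B => by simp only [wedge, map_smul, smul_mul_assoc])
    (fun A B C => by simp only [wedge, map_add, mul_add])
    (fun c A B => by simp only [wedge, map_smul, mul_smul_comm])

/-- The embedding of vectors into the multivectors as a linear map. -/
noncomputable def vecₗ (N : ℕ) : Euc N →ₗ[ℝ] GA N := CliffordAlgebra.ι (euclQ N)

/-- The exterior product of two vectors as a bilinear map. -/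
noncomputable def wedgeVec (N : ℕ) : Euc N →ₗ[ℝ] Euc N →ₗ[ℝ] GA N :=
  (wedgeₗ N).compl₁₂ (vecₗ N) (vecₗ N)

theorem wedgeVec_apply (a b : Euc N) : wedgeVec N a b = wedge (vec a) (vec b) := rfl

theorem wedgeₗ_apply (A B : GA N) : wedgeₗ N A B = wedge A B := rfl

theorem wedgeVec_self (a : Euc N) : wedgeVec N a a = 0 := by
  rw [wedgeVec_apply, wedge, equivExterior_vec, CliffordAlgebra.ι_sq_scalar]
  simp

theorem wedgeVec_swap (a b : Euc N) : wedgeVec N a b = -wedgeVec N b a := by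
  have h := wedgeVec_self (a + b)
  simp only [map_add, LinearMap.add_apply, wedgeVec_self, zero_add, add_zero] at h
  exact eq_neg_of_add_eq_zero_left ((add_comm _ _).trans h)

theorem vec_mul_vec_of_inner_eq_zero {a b : Euc N} (h : inner ℝ a b = 0) :
    vec a * vec b = wedgeVec N a b := by
  rw [vec_mul_vec, h, map_zero, zero_add, wedgeVec_apply]

theorem vec_mul_vec_swap {a b : Euc N} (h : inner ℝ a b = 0) :
    vec a * vec b = -(vec b * vec a) := by
  rw [vec_mul_vec_of_inner_eq_zero h, wedgeVec_swap,
    vec_mul_vec_of_inner_eq_zero ((real_inner_comm _ _).trans h)]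

theorem vec_mul_self (a : Euc N) : vec a * vec a = algebraMap ℝ (GA N) (inner ℝ a a) := by
  rw [vec_mul_vec, ← wedgeVec_apply, wedgeVec_self, add_zero]

/-- The exterior product of `m` vectors as an alternating map. -/
noncomputable def bladeₐ (N m : ℕ) : (Euc N) [⋀^Fin m]→ₗ[ℝ] GA N :=
  (CliffordAlgebra.equivExterior (euclQ N)).symm.toLinearMap.compAlternatingMap
    (ExteriorAlgebra.ιMulti ℝ m)

theorem bladeₐ_apply {m : ℕ} (v : Fin m → Euc N) : bladeₐ N m v = blade v := rfl

theorem contractLeft_ιMulti_eq_zero {m : ℕ} (d : Module.Dual ℝ (Euc N)) (v : Fin m → Euc N)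
    (h : ∀ i, d (v i) = 0) :
    CliffordAlgebra.contractLeft (Q := (0 : QuadraticForm ℝ (Euc N))) d
      (ExteriorAlgebra.ιMulti ℝ m v) = 0 := by
  induction m with
  | zero =>
    rw [ExteriorAlgebra.ιMulti_zero_apply]
    exact CliffordAlgebra.contractLeft_one _ _
  | succ m ih =>
    rw [ExteriorAlgebra.ιMulti_succ_apply]
    refine (CliffordAlgebra.contractLeft_ι_mul _ _ _).trans ?_
    rw [h, ih (Matrix.vecTail v) fun i => h i.succ, zero_smul, mul_zero, sub_zero]

theorem vec_mul_blade {m : ℕ} (a : Euc N) (v : Fin m → Euc N) (h : ∀ i, inner ℝ a (v i) = 0) :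
    vec a * blade v = blade (Fin.cons a v : Fin (m + 1) → Euc N) := by
  apply (CliffordAlgebra.equivExterior (euclQ N)).injective
  rw [equivExterior_vec_mul, blade, blade, LinearEquiv.apply_symm_apply,
    LinearEquiv.apply_symm_apply, contractLeft_ιMulti_eq_zero _ _ h, add_zero,
    ExteriorAlgebra.ιMulti_succ_apply]
  rfl

/-- The bivector `n τⱼ` replaces the factor `τⱼ` of an orthonormal blade by `n`. -/
theorem vec_mul_vec_mul_blade {m : ℕ} (v : Fin m → Euc N) (hv : Orthonormal ℝ v) (n : Euc N)
    (hn : ∀ i, inner ℝ n (v i) = 0) (j : Fin m) :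
    vec n * (vec (v j) * blade v) = blade (Function.update v j n) := by
  induction m with
  | zero => exact j.elim0
  | succ m ih =>
    have htail : Orthonormal ℝ (Fin.tail v) := hv.comp _ (Fin.succ_injective m)
    have hv0 : ∀ i : Fin m, inner ℝ (v 0) (Fin.tail v i) = 0 := fun i =>
      hv.2 (Fin.succ_ne_zero i).symm
    have hsplit : blade v = vec (v 0) * blade (Fin.tail v) := by
      rw [vec_mul_blade _ _ hv0, Fin.cons_self_tail]
    refine Fin.cases ?_ (fun i => ?_) j
    · rw [hsplit, ← mul_assoc (vec (v 0)), vec_mul_self, real_inner_self_eq_norm_sq, hv.1]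
      rw [one_pow, map_one, one_mul, vec_mul_blade n (Fin.tail v) fun i => hn i.succ]
      congr 1
      conv_rhs => rw [← Fin.cons_self_tail v, Fin.update_cons_zero]
    -- Moving `v 0` to the front passes two orthogonal vectors, so the two signs cancel and the
    -- induction hypothesis applies to the tail.
    · have h1 : vec (v i.succ) * vec (v 0) = -(vec (v 0) * vec (v i.succ)) :=
        vec_mul_vec_swap (hv.2 (Fin.succ_ne_zero i))
      have h2 : vec n * vec (v 0) = -(vec (v 0) * vec n) := vec_mul_vec_swap (hn 0)
      have h3 := ih (Fin.tail v) htail (fun i => hn i.succ) i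
      calc vec n * (vec (v i.succ) * blade v)
          = vec n * (vec (v i.succ) * vec (v 0) * blade (Fin.tail v)) := by rw [hsplit, mul_assoc]
        _ = vec (v 0) * (vec n * (vec (Fin.tail v i) * blade (Fin.tail v))) := by
            rw [h1, neg_mul, mul_neg, mul_assoc, ← mul_assoc (vec n), h2, neg_mul, neg_neg,
              mul_assoc]
            rfl
        _ = blade (Function.update v i.succ n) := by
            rw [h3, vec_mul_blade]
            · congr 1
              conv_rhs => rw [← Fin.cons_self_tail v, ← Fin.cons_update]
            · intro k
              by_cases hk : k = i
              · subst hk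
                rw [Function.update_self, real_inner_comm]
                exact hn 0
              · rw [Function.update_of_ne hk]
                exact hv0 k

/-- The product of two bivectors, each the product of a tangential and a normal vector. -/
theorem vec_mul_vec_mul_vec_mul_vec (s B t C : Euc N) (hsB : inner ℝ s B = 0) (hsC : inner ℝ s C = 0)
    (hBt : inner ℝ B t = 0) (htC : inner ℝ t C = 0) :
    (vec s * vec B) * (vec t * vec C) =
      wedge (wedgeVec N s B) (wedgeVec N t C) - (inner ℝ B C : ℝ) • wedgeVec N s t -
        (inner ℝ s t : ℝ) • wedgeVec N B C - algebraMap ℝ (GA N) (inner ℝ s t * inner ℝ B C) := by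
  apply (CliffordAlgebra.equivExterior (euclQ N)).injective
  have h1 : CliffordAlgebra.equivExterior (euclQ N) 1 = 1 := by
    rw [← map_one (algebraMap ℝ (GA N)), equivExterior_algebraMap, map_one]
  have hι : ∀ d : Module.Dual ℝ (Euc N), ∀ v : Euc N, CliffordAlgebra.contractLeft
      (Q := (0 : QuadraticForm ℝ (Euc N))) d (ExteriorAlgebra.ι ℝ v) = algebraMap ℝ _ (d v) :=
    fun d v => CliffordAlgebra.contractLeft_ι _ _ _
  have hm : ∀ d : Module.Dual ℝ (Euc N), ∀ v : Euc N, ∀ X : ExteriorAlgebra ℝ (Euc N),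
      CliffordAlgebra.contractLeft (Q := (0 : QuadraticForm ℝ (Euc N))) d
        (ExteriorAlgebra.ι ℝ v * X) = d v • X - ExteriorAlgebra.ι ℝ v *
          CliffordAlgebra.contractLeft (Q := (0 : QuadraticForm ℝ (Euc N))) d X :=
    fun d v X => CliffordAlgebra.contractLeft_ι_mul _ _ _
  -- Each left multiplication by a vector is an exterior product plus a contraction. By the
  -- orthogonality hypotheses only the pairs `s, t` and `B, C` contract.
  rw [mul_assoc]
  simp only [map_sub, map_smul, wedgeVec_apply, equivExterior_wedge,
    equivExterior_vec_mul, equivExterior_vec, hι, hm, innerₗ_apply_apply, htC, hBt, hsB, hsC,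
    map_zero, add_zero, zero_smul, zero_sub, mul_add, map_add, map_neg, mul_neg, mul_zero,
    sub_zero, Algebra.algebraMap_eq_smul_one, mul_smul_comm, mul_one, mul_smul, mul_assoc, h1,
    smul_comm (inner ℝ s t : ℝ) (inner ℝ B C : ℝ)]
  abel

/-- The square of a sum `∑ⱼ tⱼ ∧ Bⱼ` with orthonormal `tⱼ` and `Bⱼ` orthogonal to all `tₗ`. -/
theorem sum_vec_mul_vec_sq {κ : Type*} [Fintype κ] (t B : κ → Euc N) (ht : Orthonormal ℝ t)
    (hB : ∀ j l, inner ℝ (t j) (B l) = 0) :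
    (∑ j, wedgeVec N (t j) (B j)) * (∑ j, wedgeVec N (t j) (B j)) =
      wedge (∑ j, wedgeVec N (t j) (B j)) (∑ j, wedgeVec N (t j) (B j)) -
        algebraMap ℝ (GA N) (∑ j, ‖B j‖ ^ 2) := by
  classical
  -- The coefficients are symmetric in `j, k` and the wedge is antisymmetric. The other bivector
  -- terms, `B j ∧ B k` weighted by the inner product of `t j` and `t k`, reduce to `B j ∧ B j = 0`.
  have hanti : ∑ j, ∑ k, (inner ℝ (B j) (B k) : ℝ) • wedgeVec N (t j) (t k) = 0 := by
    have h : ∑ j, ∑ k, (inner ℝ (B j) (B k) : ℝ) • wedgeVec N (t j) (t k) =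
        -∑ j, ∑ k, (inner ℝ (B j) (B k) : ℝ) • wedgeVec N (t j) (t k) := by
      conv_lhs => rw [Finset.sum_comm]
      simp only [← Finset.sum_neg_distrib]
      refine Finset.sum_congr rfl fun j _ => Finset.sum_congr rfl fun k _ => ?_
      rw [real_inner_comm, wedgeVec_swap, smul_neg]
    rw [eq_neg_iff_add_eq_zero, ← two_smul ℝ] at h
    exact (smul_eq_zero.mp h).resolve_left two_ne_zero
  have hδ : ∀ j k, (inner ℝ (t j) (t k) : ℝ) = if j = k then 1 else 0 :=
    orthonormal_iff_ite.mp ht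
  have hprod : ∀ j k, wedgeVec N (t j) (B j) * wedgeVec N (t k) (B k) =
      wedge (wedgeVec N (t j) (B j)) (wedgeVec N (t k) (B k)) -
        (inner ℝ (B j) (B k) : ℝ) • wedgeVec N (t j) (t k) -
        algebraMap ℝ (GA N) (if j = k then ‖B k‖ ^ 2 else 0) := by
    intro j k
    rw [← vec_mul_vec_of_inner_eq_zero (hB j j), ← vec_mul_vec_of_inner_eq_zero (hB k k),
      vec_mul_vec_mul_vec_mul_vec _ _ _ _ (hB j j) (hB j k) ((real_inner_comm _ _).trans (hB k j)) (hB k k),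
      hδ, vec_mul_vec_of_inner_eq_zero (hB j j), vec_mul_vec_of_inner_eq_zero (hB k k)]
    split_ifs with h
    · subst h
      simp [wedgeVec_self]
    · simp
  have hw : wedge (∑ j, wedgeVec N (t j) (B j)) (∑ j, wedgeVec N (t j) (B j)) =
      ∑ j, ∑ k, wedge (wedgeVec N (t j) (B j)) (wedgeVec N (t k) (B k)) := by
    simp only [← wedgeₗ_apply, map_sum, LinearMap.sum_apply]
    exact Finset.sum_comm
  rw [hw, Finset.sum_mul_sum]
  simp only [hprod, Finset.sum_sub_distrib, hanti, sub_zero]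
  congr 1
  rw [map_sum]
  refine Finset.sum_congr rfl fun j _ => ?_
  rw [← map_sum]
  simp

/-! ### Multivectors as a finite-dimensional normed space -/

theorem exteriorPower_eq_bot {n : ℕ} (hn : N < n) : (⋀[ℝ]^n (Euc N)) = ⊥ := by
  rw [← Submodule.finrank_eq_zero, exteriorPower.finrank_eq, finrank_euclideanSpace_fin,
    Nat.choose_eq_zero_of_lt hn]

-- Exterior powers above degree `N` vanish, so finitely many finite-dimensional summands span.
-- Finite dimension makes every linear or bilinear operation on multivectors continuous, hence
-- differentiable.
scoped instance finite_exteriorAlgebra : Module.Finite ℝ (ExteriorAlgebra ℝ (Euc N)) := by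
  refine ⟨?_⟩
  have h : (⨆ i ∈ Finset.range (N + 1), ⋀[ℝ]^i (Euc N)) =
      (⊤ : Submodule ℝ (ExteriorAlgebra ℝ (Euc N))) := by
    rw [eq_top_iff, ← (DirectSum.Decomposition.isInternal
      fun i : ℕ => ⋀[ℝ]^i (Euc N)).submodule_iSup_eq_top]
    refine iSup_le fun i => ?_
    by_cases hi : i < N + 1
    · exact le_iSup₂_of_le i (Finset.mem_range.mpr hi) le_rfl
    · rw [exteriorPower_eq_bot (by omega)]
      exact bot_le
  rw [← h]
  exact Submodule.fg_biSup _ _ fun i _ => Module.Finite.iff_fg.mp inferInstance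

scoped instance finite_multivectors : Module.Finite ℝ (GA N) :=
  Module.Finite.equiv (CliffordAlgebra.equivExterior (euclQ N)).symm

/-- A norm on the space of multivectors; all norms are equivalent. -/
noncomputable scoped instance normedMultivectors : NormedAddCommGroup (GA N) :=
  NormedAddCommGroup.induced (GA N) (Fin (Module.finrank ℝ (GA N)) → ℝ)
    (Module.finBasis ℝ (GA N)).equivFun (Module.finBasis ℝ (GA N)).equivFun.injective

noncomputable scoped instance normedSpaceMultivectors : NormedSpace ℝ (GA N) :=
  NormedSpace.induced ℝ (GA N) (Fin (Module.finrank ℝ (GA N)) → ℝ)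
    (Module.finBasis ℝ (GA N)).equivFun

/-- The geometric product as a continuous bilinear map. -/
noncomputable def mulL (N : ℕ) : GA N →L[ℝ] GA N →L[ℝ] GA N :=
  (LinearMap.mul ℝ (GA N)).toContinuousBilinearMap

theorem mulL_apply (A B : GA N) : mulL N A B = A * B := rfl

/-- The exterior product of two vectors as a continuous bilinear map. -/
noncomputable def wedgeVecL (N : ℕ) : Euc N →L[ℝ] Euc N →L[ℝ] GA N :=
  (wedgeVec N).toContinuousBilinearMap

theorem wedgeVecL_apply (a b : Euc N) : wedgeVecL N a b = wedgeVec N a b := rfl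

theorem blade_succ {m : ℕ} (v : Fin (m + 1) → Euc N) :
    blade v = wedge (vec (v 0)) (blade fun i => v i.succ) := by
  apply (CliffordAlgebra.equivExterior (euclQ N)).injective
  rw [equivExterior_wedge, equivExterior_vec, blade, blade, LinearEquiv.apply_symm_apply,
    LinearEquiv.apply_symm_apply, ExteriorAlgebra.ιMulti_succ_apply]
  rfl

theorem continuous_blade (m : ℕ) : Continuous (blade : (Fin m → Euc N) → GA N) := by
  induction m with
  | zero => exact continuous_of_const fun v w => congrArg blade (Subsingleton.elim v w)
  | succ m ih =>
    have h : (blade : (Fin (m + 1) → Euc N) → GA N) = fun v =>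
        ((wedgeₗ N).compl₁₂ (vecₗ N) LinearMap.id).toContinuousBilinearMap (v 0)
          (blade fun i => v i.succ) := funext blade_succ
    rw [h]
    have h2 : Continuous fun v : Fin (m + 1) → Euc N => blade fun i => v i.succ :=
      ih.comp (by fun_prop)
    fun_prop

/-- The exterior product of `m` vectors as a continuous multilinear map. -/
noncomputable def bladeL (N m : ℕ) :
    ContinuousMultilinearMap ℝ (fun _ : Fin m => Euc N) (GA N) where
  toMultilinearMap := (bladeₐ N m).toMultilinearMap
  cont := continuous_blade m

/-- The product rule for the exterior product of vector fields. -/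
theorem HasFDerivAt.blade {m : ℕ} {G : Type*} [NormedAddCommGroup G] [NormedSpace ℝ G]
    {τ : Fin m → G → Euc N} {τ' : Fin m → G →L[ℝ] Euc N} {x : G}
    (h : ∀ j, HasFDerivAt (τ j) (τ' j) x) :
    ∃ T' : G →L[ℝ] GA N, HasFDerivAt (fun y => GeomCalc.blade fun j => τ j y) T' x ∧
      ∀ a, T' a = ∑ j, GeomCalc.blade (Function.update (fun j => τ j x) j (τ' j a)) := by
  refine ⟨_, HasFDerivAt.multilinear_comp (bladeL N m) h, fun a => ?_⟩
  rw [sum_apply]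
  rfl

/-- The scalar product with a fixed multivector as a linear functional. -/
noncomputable def ipL (I : GA N) : GA N →L[ℝ] ℝ :=
  LinearMap.toContinuousLinearMap
    (ExteriorAlgebra.algebraMapInv.toLinearMap ∘ₗ
      (CliffordAlgebra.equivExterior (euclQ N)).toLinearMap ∘ₗ
        LinearMap.mulRight ℝ (CliffordAlgebra.reverse I))

theorem ipL_apply (I A : GA N) : ipL I A = ip A I := rfl

/-! ### Local charts and smooth orthonormal frames -/

section Frame

variable {G E : Type*} [NormedAddCommGroup G] [NormedSpace ℝ G] [NormedAddCommGroup E]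
  [InnerProductSpace ℝ E]

/-- Strong induction along the Gram–Schmidt recursion. Linear independence keeps the denominators
nonzero. -/
theorem contDiffOn_gramSchmidt {m : ℕ} {n : ℕ∞ω} {f : Fin m → G → E} {U : Set G}
    (hf : ∀ j, ContDiffOn ℝ n (f j) U)
    (hli : ∀ y ∈ U, LinearIndependent ℝ fun j => f j y) (j : Fin m) :
    ContDiffOn ℝ n (fun y => InnerProductSpace.gramSchmidt ℝ (fun i => f i y) j) U := by
  induction j using WellFoundedLT.induction with
  | _ j ih =>
    have h : ∀ y, InnerProductSpace.gramSchmidt ℝ (fun i => f i y) j = f j y -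
        ∑ i ∈ Finset.Iio j, (inner ℝ (InnerProductSpace.gramSchmidt ℝ (fun i => f i y) i) (f j y) /
          ‖InnerProductSpace.gramSchmidt ℝ (fun i => f i y) i‖ ^ 2) •
            InnerProductSpace.gramSchmidt ℝ (fun i => f i y) i := fun y =>
      eq_sub_of_add_eq (InnerProductSpace.gramSchmidt_def'' ℝ (fun i => f i y) j).symm
    simp only [h]
    refine (hf j).sub (ContDiffOn.sum fun i hi => ?_)
    have hi' := ih i (Finset.mem_Iio.mp hi)
    refine ((hi'.inner ℝ (hf j)).div (hi'.norm_sq ℝ) fun y hy => ?_).smul hi'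
    exact pow_ne_zero _ (norm_ne_zero_iff.mpr
      (InnerProductSpace.gramSchmidt_ne_zero i (hli y hy)))

theorem contDiffOn_gramSchmidtNormed {m : ℕ} {n : ℕ∞ω} {f : Fin m → G → E} {U : Set G}
    (hf : ∀ j, ContDiffOn ℝ n (f j) U)
    (hli : ∀ y ∈ U, LinearIndependent ℝ fun j => f j y) (j : Fin m) :
    ContDiffOn ℝ n (fun y => InnerProductSpace.gramSchmidtNormed ℝ (fun i => f i y) j) U := by
  have h := contDiffOn_gramSchmidt hf hli j
  have hne : ∀ y ∈ U, InnerProductSpace.gramSchmidt ℝ (fun i => f i y) j ≠ 0 := fun y hy =>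
    InnerProductSpace.gramSchmidt_ne_zero j (hli y hy)
  exact ((h.norm ℝ hne).inv fun y hy => norm_ne_zero_iff.mpr (hne y hy)).smul h

end Frame

/-- The orthogonal projection onto the span of an orthonormal frame. -/
noncomputable def frameProj {κ : Type*} [Fintype κ] (τ : κ → Euc N) : Euc N →L[ℝ] Euc N :=
  ∑ j, (innerSL ℝ (τ j)).smulRight (τ j)

theorem frameProj_apply {κ : Type*} [Fintype κ] (τ : κ → Euc N) (v : Euc N) :
    frameProj τ v = ∑ j, (inner ℝ (τ j) v : ℝ) • τ j := by
  simp [frameProj]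

theorem frameProj_eq_starProjection {κ : Type*} [Fintype κ] {τ : κ → Euc N} (h : Orthonormal ℝ τ)
    {W : Submodule ℝ (Euc N)} (hW : Submodule.span ℝ (Set.range τ) = W) (v : Euc N) :
    frameProj τ v = W.starProjection v := by
  symm
  apply Submodule.eq_starProjection_of_mem_orthogonal
  · rw [frameProj_apply, ← hW]
    exact Submodule.sum_mem _ fun j _ =>
      Submodule.smul_mem _ _ (Submodule.subset_span (Set.mem_range_self j))
  · rw [← hW, Submodule.mem_orthogonal]
    intro u hu
    induction hu using Submodule.span_induction with
    | mem u hu =>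
      obtain ⟨i, rfl⟩ := hu
      rw [frameProj_apply, inner_sub_right, h.inner_right_fintype, sub_self]
    | zero => rw [inner_zero_left]
    | add u w _ _ hu hw => rw [inner_add_left, hu, hw, add_zero]
    | smul c u _ hu => rw [inner_smul_left, hu, mul_zero]

theorem contDiffOn_frameProj {m : ℕ} {τ : Fin m → Euc N → Euc N} {U : Set (Euc N)}
    (hτ : ∀ j, ContDiffOn ℝ ∞ (τ j) U) :
    ContDiffOn ℝ ∞ (fun y => frameProj fun j => τ j y) U :=
  ContDiffOn.sum fun j _ => ((innerSL ℝ).contDiff.comp_contDiffOn (hτ j)).smulRight (hτ j)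

/-- Bounded curve through the origin with unit speed there. -/
theorem hasDerivAt_bounded_sin (ε : ℝ) (hε : ε ≠ 0) :
    HasDerivAt (fun t : ℝ => ε * Real.sin (t / ε)) 1 0 := by
  have h : HasDerivAt (fun t : ℝ => t / ε) (1 / ε) 0 := (hasDerivAt_id 0).div_const ε
  simpa [hε] using h.sin.const_mul ε

section Chart

variable {M : Set (Euc N)} {Φ : OpenPartialHomeomorph (Euc N) (Euc N)} {L : Submodule ℝ (Euc N)}

theorem fderiv_symm_comp_fderiv (h1 : ContDiffOn ℝ ∞ Φ Φ.source)
    (h2 : ContDiffOn ℝ ∞ Φ.symm Φ.target) {y : Euc N} (hy : y ∈ Φ.source) (v : Euc N) :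
    fderiv ℝ Φ.symm (Φ y) (fderiv ℝ Φ y v) = v := by
  have d1 : HasFDerivAt Φ (fderiv ℝ Φ y) y :=
    ((h1.contDiffAt (Φ.open_source.mem_nhds hy)).differentiableAt (by simp)).hasFDerivAt
  have d2 : HasFDerivAt Φ.symm (fderiv ℝ Φ.symm (Φ y)) (Φ y) :=
    ((h2.contDiffAt (Φ.open_target.mem_nhds (Φ.map_source hy))).differentiableAt
      (by simp)).hasFDerivAt
  have h := d2.comp y d1
  have h' : HasFDerivAt (Φ.symm ∘ Φ) (ContinuousLinearMap.id ℝ (Euc N)) y :=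
    (hasFDerivAt_id y).congr_of_eventuallyEq
      (Filter.eventually_of_mem (Φ.open_source.mem_nhds hy) fun z hz => Φ.left_inv hz)
  exact DFunLike.congr_fun (h.unique h') v

theorem fderiv_comp_fderiv_symm (h1 : ContDiffOn ℝ ∞ Φ Φ.source)
    (h2 : ContDiffOn ℝ ∞ Φ.symm Φ.target) {y : Euc N} (hy : y ∈ Φ.source) (v : Euc N) :
    fderiv ℝ Φ y (fderiv ℝ Φ.symm (Φ y) v) = v := by
  have h := fderiv_symm_comp_fderiv (Φ := Φ.symm) h2 (by simpa using h1) (Φ.map_source hy) v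
  rwa [Φ.symm_symm, Φ.left_inv hy] at h

/-- In a straightening chart the tangent space is the preimage of the model subspace. -/
theorem tangentSpace_eq_map (h1 : ContDiffOn ℝ ∞ Φ Φ.source)
    (h2 : ContDiffOn ℝ ∞ Φ.symm Φ.target) (hL : ∀ y ∈ Φ.source, Φ y ∈ L ↔ y ∈ M)
    {y : Euc N} (hy : y ∈ Φ.source) (hyM : y ∈ M) :
    tangentSpace M y = L.map (fderiv ℝ Φ.symm (Φ y)).toLinearMap := by
  apply le_antisymm
  · refine Submodule.span_le.mpr ?_
    rintro v ⟨c, hcM, rfl, hc⟩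
    have d1 : HasFDerivAt Φ (fderiv ℝ Φ (c 0)) (c 0) :=
      ((h1.contDiffAt (Φ.open_source.mem_nhds hy)).differentiableAt (by simp)).hasFDerivAt
    have hd := (Lᗮ.starProjection.hasFDerivAt (x := Φ (c 0))).comp_hasDerivAt 0
      (d1.comp_hasDerivAt 0 hc)
    -- In the chart the curve stays in `L` near time `0`, so its component orthogonal to `L`
    -- vanishes there.
    have hz : HasDerivAt (Lᗮ.starProjection ∘ Φ ∘ c) 0 0 := by
      refine (hasDerivAt_const (0 : ℝ) (0 : Euc N)).congr_of_eventuallyEq ?_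
      filter_upwards [hc.continuousAt.preimage_mem_nhds (Φ.open_source.mem_nhds hy)] with t ht
      have : Φ (c t) ∈ L := (hL _ ht).mpr (hcM t)
      exact (Submodule.starProjection_apply_eq_zero_iff _).mpr
        (Submodule.le_orthogonal_orthogonal L this)
    have h0 := hd.unique hz
    rw [Submodule.starProjection_apply_eq_zero_iff, Submodule.orthogonal_orthogonal] at h0
    exact ⟨_, h0, fderiv_symm_comp_fderiv h1 h2 hy v⟩
  · rintro _ ⟨l, hl, rfl⟩
    apply Submodule.subset_span
    have hcont : Continuous fun s : ℝ => Φ y + s • l := by fun_prop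
    have hmem : (fun s : ℝ => Φ y + s • l) ⁻¹' Φ.target ∈ nhds (0 : ℝ) :=
      hcont.continuousAt.preimage_mem_nhds
        (by simpa using Φ.open_target.mem_nhds (Φ.map_source hy))
    obtain ⟨ε, hε, hball⟩ := Metric.mem_nhds_iff.mp hmem
    have htar : ∀ t : ℝ, Φ y + (ε / 2 * Real.sin (t / (ε / 2))) • l ∈ Φ.target := by
      intro t
      apply hball
      rw [Metric.mem_ball, dist_zero_right, norm_mul, Real.norm_eq_abs, Real.norm_eq_abs,
        abs_of_pos (half_pos hε)]
      have := Real.abs_sin_le_one (t / (ε / 2))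
      nlinarith
    -- Curves in the definition of `tangentSpace` must lie in `M` for all real times. The line
    -- through `Φ y` is therefore run with a bounded parameter, of amplitude `ε / 2` to stay inside
    -- the open ball and of unit speed at `0`.
    refine ⟨fun t => Φ.symm (Φ y + (ε / 2 * Real.sin (t / (ε / 2))) • l), fun t => ?_, ?_, ?_⟩
    · rw [← hL _ (Φ.map_target (htar t)), Φ.right_inv (htar t)]
      exact L.add_mem ((hL y hy).mpr hyM) (L.smul_mem _ hl)
    · simp [Φ.left_inv hy]
    · have d2 : HasFDerivAt Φ.symm (fderiv ℝ Φ.symm (Φ y)) (Φ y) :=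
        ((h2.contDiffAt (Φ.open_target.mem_nhds (Φ.map_source hy))).differentiableAt
          (by simp)).hasFDerivAt
      have hs : HasDerivAt (fun t : ℝ => Φ y + (ε / 2 * Real.sin (t / (ε / 2))) • l)
          ((1 : ℝ) • l) 0 :=
        ((hasDerivAt_bounded_sin (ε / 2) (half_pos hε).ne').smul_const l).const_add _
      rw [one_smul] at hs
      refine HasFDerivAt.comp_hasDerivAt (0 : ℝ) ?_ hs
      simpa using d2

/-- The derivative of an orthogonal projection field along vector fields that it fixes and that
have a symmetric derivative is symmetric. -/
theorem fderiv_proj_symm (h1 : ContDiffOn ℝ ∞ Φ Φ.source)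
    (h2 : ContDiffOn ℝ ∞ Φ.symm Φ.target) {Q : Euc N → Euc N →L[ℝ] Euc N}
    (hQ : ContDiffOn ℝ ∞ Q Φ.source)
    (hfix : ∀ z ∈ Φ.source, ∀ l ∈ L, Q z (fderiv ℝ Φ.symm (Φ z) l) = fderiv ℝ Φ.symm (Φ z) l)
    {y : Euc N} (hy : y ∈ Φ.source) {k l : Euc N} (hk : k ∈ L) (hl : l ∈ L) :
    fderiv ℝ Q y (fderiv ℝ Φ.symm (Φ y) k) (fderiv ℝ Φ.symm (Φ y) l) =
      fderiv ℝ Q y (fderiv ℝ Φ.symm (Φ y) l) (fderiv ℝ Φ.symm (Φ y) k) := by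
  have hyn := Φ.open_source.mem_nhds hy
  have hΦy := Φ.open_target.mem_nhds (Φ.map_source hy)
  have d1 : HasFDerivAt Φ (fderiv ℝ Φ y) y :=
    ((h1.contDiffAt hyn).differentiableAt (by simp)).hasFDerivAt
  have dQ : HasFDerivAt Q (fderiv ℝ Q y) y :=
    ((hQ.contDiffAt hyn).differentiableAt (by simp)).hasFDerivAt
  have d2 : HasFDerivAt (fderiv ℝ Φ.symm) (fderiv ℝ (fderiv ℝ Φ.symm) (Φ y)) (Φ y) :=
    (((h2.contDiffAt hΦy).fderiv_right (m := 1) (by norm_cast)).differentiableAt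
      (by simp)).hasFDerivAt
  have hsymm : IsSymmSndFDerivAt ℝ Φ.symm (Φ y) :=
    (h2.contDiffAt hΦy).isSymmSndFDerivAt (by simp; norm_cast)
  -- Differentiate the identity `Q f = f` for the coordinate field `f` belonging to `l'`. The
  -- right-hand side is built from the second derivative of `Φ.symm`, which is symmetric.
  have key : ∀ k' l' : Euc N, l' ∈ L →
      fderiv ℝ Q y (fderiv ℝ Φ.symm (Φ y) k') (fderiv ℝ Φ.symm (Φ y) l') =
        fderiv ℝ (fderiv ℝ Φ.symm) (Φ y) k' l' -
          Q y (fderiv ℝ (fderiv ℝ Φ.symm) (Φ y) k' l') := by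
    intro k' l' hl'
    have df : HasFDerivAt (fun z => fderiv ℝ Φ.symm (Φ z) l') _ y :=
      (d2.comp y d1).clm_apply (hasFDerivAt_const l' y)
    have h3 := (dQ.clm_apply df).unique (df.congr_of_eventuallyEq
      (Filter.eventually_of_mem hyn fun z hz => hfix z hz l' hl'))
    have h4 := DFunLike.congr_fun h3 (fderiv ℝ Φ.symm (Φ y) k')
    simp only [add_apply, ContinuousLinearMap.comp_apply,
      ContinuousLinearMap.flip_apply, zero_apply, map_zero, zero_add,
      fderiv_comp_fderiv_symm h1 h2 hy] at h4
    exact eq_sub_of_add_eq' h4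
  rw [key k l hl, key l k hk, hsymm.eq k l]

end Chart

/-- A smooth orthonormal frame of `M` on an open set `U` of the ambient space, such that the
derivative of the associated projection is symmetric on tangent vectors. -/
structure IsAdaptedFrame {m : ℕ} (M U : Set (Euc N)) (τ : Fin m → Euc N → Euc N) : Prop where
  isOpen : IsOpen U
  contDiffOn : ∀ j, ContDiffOn ℝ ∞ (τ j) U
  orthonormal : ∀ y ∈ U, Orthonormal ℝ fun j => τ j y
  span_eq : ∀ y ∈ U, y ∈ M → Submodule.span ℝ (Set.range fun j => τ j y) = tangentSpace M y
  fderiv_symm : ∀ y ∈ U, y ∈ M → ∀ a ∈ tangentSpace M y, ∀ b ∈ tangentSpace M y,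
    fderiv ℝ (fun z => frameProj fun j => τ j z) y a b =
      fderiv ℝ (fun z => frameProj fun j => τ j z) y b a

/-- A basis of the model subspace, pushed forward by the derivative of `Φ.symm`, gives smooth
independent fields on the whole chart domain. Gram–Schmidt makes them orthonormal without changing
their span. -/
theorem IsSmoothSubmanifold.exists_adaptedFrame {m : ℕ} {M : Set (Euc N)}
    (hM : IsSmoothSubmanifold m M) {x : Euc N} (hx : x ∈ M) :
    ∃ (U : Set (Euc N)) (τ : Fin m → Euc N → Euc N), x ∈ U ∧ IsAdaptedFrame M U τ := by
  obtain ⟨Φ, L, hxΦ, h1, h2, hdim, hL⟩ := hM x hx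
  let b := Module.finBasisOfFinrankEq ℝ L hdim
  let f : Fin m → Euc N → Euc N := fun j y => fderiv ℝ Φ.symm (Φ y) (b j)
  have hf : ∀ j, ContDiffOn ℝ ∞ (f j) Φ.source := by
    intro j
    have h3 : ContDiffOn ℝ ∞ (fderiv ℝ Φ.symm) Φ.target :=
      h2.fderiv_of_isOpen Φ.open_target (by simp)
    exact (h3.comp h1 Φ.mapsTo).clm_apply contDiffOn_const
  have hli : ∀ y ∈ Φ.source, LinearIndependent ℝ fun j => f j y := by
    intro y hy
    have hb : LinearIndependent ℝ fun j => (b j : Euc N) :=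
      b.linearIndependent.map' L.subtype (Submodule.ker_subtype L)
    refine hb.map' (fderiv ℝ Φ.symm (Φ y)).toLinearMap (LinearMap.ker_eq_bot.mpr ?_)
    exact Function.LeftInverse.injective (g := fderiv ℝ Φ y) (fderiv_comp_fderiv_symm h1 h2 hy)
  have hspan : ∀ y, Submodule.span ℝ (Set.range fun j => f j y) =
      L.map (fderiv ℝ Φ.symm (Φ y)).toLinearMap := by
    intro y
    have h3 : L = Submodule.span ℝ (Set.range fun j => (b j : Euc N)) := by
      have := congrArg (Submodule.map L.subtype) b.span_eq
      rw [Submodule.map_span, ← Set.range_comp, Submodule.map_top, Submodule.range_subtype] at this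
      exact this.symm
    conv_rhs => rw [h3, Submodule.map_span, ← Set.range_comp]
    rfl
  let τ : Fin m → Euc N → Euc N := fun j y =>
    InnerProductSpace.gramSchmidtNormed ℝ (fun i => f i y) j
  have hτ : ∀ j, ContDiffOn ℝ ∞ (τ j) Φ.source := contDiffOn_gramSchmidtNormed hf hli
  have hon : ∀ y ∈ Φ.source, Orthonormal ℝ fun j => τ j y := fun y hy =>
    InnerProductSpace.gramSchmidtNormed_orthonormal (hli y hy)
  have hspan' : ∀ y, Submodule.span ℝ (Set.range fun j => τ j y) =
      L.map (fderiv ℝ Φ.symm (Φ y)).toLinearMap := fun y => by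
    rw [← hspan y]
    exact (InnerProductSpace.span_gramSchmidtNormed_range _).trans
      (InnerProductSpace.span_gramSchmidt ℝ _)
  refine ⟨Φ.source, τ, hxΦ, Φ.open_source, hτ, hon, fun y hy hyM => ?_, fun y hy hyM => ?_⟩
  · rw [hspan', tangentSpace_eq_map h1 h2 hL hy hyM]
  · rw [tangentSpace_eq_map h1 h2 hL hy hyM]
    rintro _ ⟨k, hk, rfl⟩ _ ⟨l, hl, rfl⟩
    refine fderiv_proj_symm h1 h2 (contDiffOn_frameProj hτ) (fun z hz l hl => ?_) hy hk hl
    rw [frameProj_eq_starProjection (hon z hz) (hspan' z)]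
    exact Submodule.starProjection_eq_self_iff.mpr ⟨l, hl, rfl⟩

/-! ### Frames and traces -/

/-- The standard basis of `ℝᴺ`. -/
noncomputable def stdVec (N : ℕ) (i : Fin N) : Euc N := EuclideanSpace.basisFun (Fin N) ℝ i

theorem sum_inner_smul_stdVec (v : Euc N) :
    ∑ i, (inner ℝ (stdVec N i) v : ℝ) • stdVec N i = v :=
  (EuclideanSpace.basisFun (Fin N) ℝ).sum_repr' v

/-- A trace over the tangent space is a trace over the ambient space. -/
theorem sum_stdVec_frameProj {κ F : Type*} [Fintype κ] [AddCommGroup F] [Module ℝ F]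
    (t : κ → Euc N) (β : Euc N →ₗ[ℝ] Euc N →ₗ[ℝ] F) :
    ∑ i, β (stdVec N i) (frameProj t (stdVec N i)) = ∑ j, β (t j) (t j) := by
  simp only [frameProj_apply, map_sum, map_smul]
  rw [Finset.sum_comm]
  refine Finset.sum_congr rfl fun j _ => ?_
  have h := congrArg (β.flip (t j)) (sum_inner_smul_stdVec (t j))
  simp only [map_sum, map_smul, LinearMap.flip_apply] at h
  rw [← h]
  exact Finset.sum_congr rfl fun i _ => by rw [real_inner_comm]

/-- Exchanging the two indices turns the sum into its own negative. -/
theorem sum_smul_wedgeVec_eq_zero {κ : Type*} [Fintype κ] (t : κ → Euc N) (c : κ → κ → ℝ)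
    (hc : ∀ j l, c j l = c l j) : ∑ j, wedgeVec N (t j) (∑ l, c j l • t l) = 0 := by
  have h : ∑ j, wedgeVec N (t j) (∑ l, c j l • t l) =
      -∑ j, wedgeVec N (t j) (∑ l, c j l • t l) := by
    simp only [map_sum, map_smul]
    conv_lhs => rw [Finset.sum_comm]
    simp only [← Finset.sum_neg_distrib]
    refine Finset.sum_congr rfl fun j _ => Finset.sum_congr rfl fun k _ => ?_
    rw [hc, wedgeVec_swap, smul_neg]
  rw [eq_neg_iff_add_eq_zero, ← two_smul ℝ] at h
  exact (smul_eq_zero.mp h).resolve_left two_ne_zero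

theorem frameProj_frameProj {κ : Type*} [Fintype κ] {t : κ → Euc N} (ht : Orthonormal ℝ t)
    (v : Euc N) : frameProj t (frameProj t v) = frameProj t v := by
  rw [frameProj_apply, frameProj_apply]
  exact Finset.sum_congr rfl fun j _ => by rw [ht.inner_right_fintype]

theorem inner_frameProj {κ : Type*} [Fintype κ] (t : κ → Euc N) (u v : Euc N) :
    inner ℝ (frameProj t u) v = inner ℝ u (frameProj t v) := by
  simp only [frameProj_apply, sum_inner, inner_sum, inner_smul_left, inner_smul_right]
  refine Finset.sum_congr rfl fun j _ => ?_
  rw [real_inner_comm (t j) u]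
  exact mul_comm _ _

/-- An alternating map in top degree is a multiple of the determinant, and the determinant between
orthonormal bases is `1` or `-1`. -/
theorem blade_orthonormalBasis_eq_or_neg {m : ℕ} {W : Submodule ℝ (Euc N)}
    (a b : OrthonormalBasis (Fin m) ℝ W) :
    blade (fun j => (a j : Euc N)) = blade (fun j => (b j : Euc N)) ∨
      blade (fun j => (a j : Euc N)) = -blade (fun j => (b j : Euc N)) := by
  have h : (bladeₐ N m).compLinearMap W.subtype =
      (LinearMap.toSpanSingleton ℝ (GA N) (blade fun j => (b j : Euc N))).compAlternatingMap
        b.toBasis.det := by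
    refine b.toBasis.ext_alternating fun v hv => ?_
    let σ : Equiv.Perm (Fin m) := Equiv.ofBijective v (Finite.injective_iff_bijective.mp hv)
    have h1 := ((bladeₐ N m).compLinearMap W.subtype).map_perm b.toBasis σ
    have h2 := ((LinearMap.toSpanSingleton ℝ (GA N)
      (blade fun j => (b j : Euc N))).compAlternatingMap b.toBasis.det).map_perm b.toBasis σ
    refine (h1.trans ?_).trans h2.symm
    congr 1
    rw [LinearMap.compAlternatingMap_apply, b.toBasis.det_self, LinearMap.toSpanSingleton_apply,
      one_smul, OrthonormalBasis.coe_toBasis]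
    rfl
  have h3 := congrArg (fun f => f a) h
  simp only [LinearMap.compAlternatingMap_apply, LinearMap.toSpanSingleton_apply] at h3
  have h4 : ((bladeₐ N m).compLinearMap W.subtype) a = blade fun j => (a j : Euc N) := rfl
  rw [h4] at h3
  rcases b.det_to_matrix_orthonormalBasis_real a with h5 | h5
  · left
    rw [h3, h5, one_smul]
  · right
    rw [h3, h5, neg_one_smul]

section Tau

variable {M : Set (Euc N)}

theorem orthonormal_tau (M : Set (Euc N)) (x : Euc N) : Orthonormal ℝ (tau M x) :=
  (stdOrthonormalBasis ℝ (tangentSpace M x)).orthonormal.comp_linearIsometry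
    (tangentSpace M x).subtypeₗᵢ

theorem tau_mem (M : Set (Euc N)) (x : Euc N) (j) : tau M x j ∈ tangentSpace M x :=
  (stdOrthonormalBasis ℝ (tangentSpace M x) j).2

theorem span_tau (M : Set (Euc N)) (x : Euc N) :
    Submodule.span ℝ (Set.range (tau M x)) = tangentSpace M x := by
  have := congrArg (Submodule.map (tangentSpace M x).subtype)
    (stdOrthonormalBasis ℝ (tangentSpace M x)).toBasis.span_eq
  rw [Submodule.map_span, ← Set.range_comp, Submodule.map_top, Submodule.range_subtype] at this
  rw [OrthonormalBasis.coe_toBasis] at this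
  exact this

theorem frameProj_tau (M : Set (Euc N)) (x v : Euc N) : frameProj (tau M x) v = proj M x v :=
  frameProj_eq_starProjection (orthonormal_tau M x) (span_tau M x) v

theorem sum_inner_nu_sq {x v : Euc N} (hv : v ∈ (tangentSpace M x)ᗮ) :
    ∑ α, (inner ℝ (nu M x α) v) ^ 2 = ‖v‖ ^ 2 := by
  have h := (stdOrthonormalBasis ℝ (tangentSpace M x)ᗮ).sum_sq_norm_inner_right ⟨v, hv⟩
  simp only [Real.norm_eq_abs, sq_abs] at h
  exact h

end Tau

/-- The derivative on `M` of a function that has a differentiable extension. -/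
theorem dirDeriv_eq {F : Type*} [NormedAddCommGroup F] [NormedSpace ℝ F] {M : Set (Euc N)}
    {f g : Euc N → F} {g' : Euc N →L[ℝ] F} {x a : Euc N} {U : Set (Euc N)} (hx : x ∈ M)
    (hU : U ∈ nhds x) (hg : HasFDerivAt g g' x) (hfg : ∀ y ∈ U, y ∈ M → f y = g y)
    (ha : a ∈ tangentSpace M x) : dirDeriv M f x a = g' a := by
  have hf : HasFDerivWithinAt f g' M x := by
    refine hg.hasFDerivWithinAt.congr_of_eventuallyEq ?_ (hfg x (mem_of_mem_nhds hU) hx)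
    filter_upwards [mem_nhdsWithin_of_mem_nhds hU, self_mem_nhdsWithin] with y hy hyM
    exact hfg y hy hyM
  -- `M` need not determine `fderivWithin` in normal directions. It does so on velocities of curves
  -- in `M`, hence by linearity on their span.
  induction ha using Submodule.span_induction with
  | mem v hv =>
    obtain ⟨c, hcM, hc0, hc⟩ := hv
    have h1 := hasDerivAt_comp_curve hf.differentiableWithinAt hcM hc0 hc
    subst hc0
    exact h1.unique (hf.comp_hasDerivAt 0 hc (Filter.Eventually.of_forall hcM))
  | zero => rw [dirDeriv, map_zero, map_zero]
  | add u w _ _ hu hw => rw [dirDeriv, map_add, map_add, ← hu, ← hw, dirDeriv, dirDeriv]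
  | smul c u _ hu => rw [dirDeriv, map_smul, map_smul, ← hu, dirDeriv]

/-! ### Local tensors of a submanifold -/

section Local

variable {m : ℕ} {M U : Set (Euc N)} {τ : Fin m → Euc N → Euc N}

/-- The field of projections of a family of vector fields. -/
noncomputable def projField (τ : Fin m → Euc N → Euc N) (y : Euc N) : Euc N →L[ℝ] Euc N :=
  frameProj fun j => τ j y

namespace IsAdaptedFrame

theorem contDiffOn_projField (h : IsAdaptedFrame M U τ) : ContDiffOn ℝ ∞ (projField τ) U :=
  contDiffOn_frameProj h.contDiffOn

theorem mem_nhds (h : IsAdaptedFrame M U τ) {y : Euc N} (hy : y ∈ U) : U ∈ nhds y :=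
  h.isOpen.mem_nhds hy

theorem hasFDerivAt_projField (h : IsAdaptedFrame M U τ) {y : Euc N} (hy : y ∈ U) :
    HasFDerivAt (projField τ) (fderiv ℝ (projField τ) y) y :=
  ((h.contDiffOn_projField.contDiffAt (h.mem_nhds hy)).differentiableAt (by simp)).hasFDerivAt

theorem projField_eq_proj (h : IsAdaptedFrame M U τ) {y : Euc N} (hy : y ∈ U) (hyM : y ∈ M)
    (v : Euc N) : projField τ y v = proj M y v :=
  frameProj_eq_starProjection (h.orthonormal y hy) (h.span_eq y hy hyM) v

theorem projField_eq_frameProj_tau (h : IsAdaptedFrame M U τ) {y : Euc N} (hy : y ∈ U)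
    (hyM : y ∈ M) : projField τ y = frameProj (tau M y) :=
  ContinuousLinearMap.ext fun v => by rw [h.projField_eq_proj hy hyM, frameProj_tau]

theorem projField_of_mem (h : IsAdaptedFrame M U τ) {y : Euc N} (hy : y ∈ U) (hyM : y ∈ M)
    {v : Euc N} (hv : v ∈ tangentSpace M y) : projField τ y v = v := by
  rw [h.projField_eq_proj hy hyM]
  exact Submodule.starProjection_eq_self_iff.mpr hv

theorem frame_mem (h : IsAdaptedFrame M U τ) {y : Euc N} (hy : y ∈ U) (hyM : y ∈ M)
    (j : Fin m) : τ j y ∈ tangentSpace M y :=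
  (h.span_eq y hy hyM) ▸ Submodule.subset_span (Set.mem_range_self j)

theorem mem_orthogonal_iff (h : IsAdaptedFrame M U τ) {y : Euc N} (hy : y ∈ U) (hyM : y ∈ M)
    (v : Euc N) : v ∈ (tangentSpace M y)ᗮ ↔ projField τ y v = 0 := by
  rw [h.projField_eq_proj hy hyM, proj, Submodule.starProjection_apply_eq_zero_iff]

theorem fderiv_projField_symm (h : IsAdaptedFrame M U τ) {y : Euc N} (hy : y ∈ U) (hyM : y ∈ M)
    {a b : Euc N} (ha : a ∈ tangentSpace M y) (hb : b ∈ tangentSpace M y) :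
    fderiv ℝ (projField τ) y a b = fderiv ℝ (projField τ) y b a :=
  h.fderiv_symm y hy hyM a ha b hb

/-- The derivative of $P^2=P$. It forces $D_aP$ to exchange tangent and normal vectors. -/
theorem fderiv_projField_split (h : IsAdaptedFrame M U τ) {y : Euc N} (hy : y ∈ U)
    (a v : Euc N) :
    projField τ y (fderiv ℝ (projField τ) y a v) +
      fderiv ℝ (projField τ) y a (projField τ y v) = fderiv ℝ (projField τ) y a v := by
  have d := h.hasFDerivAt_projField hy
  have d1 := d.clm_apply (hasFDerivAt_const v y)
  have d2 := (d.clm_apply d1).congr_of_eventuallyEq (f₁ := fun z => projField τ z v)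
    (Filter.eventually_of_mem (h.mem_nhds hy) fun z hz =>
      (frameProj_frameProj (h.orthonormal z hz) v).symm)
  have d3 := DFunLike.congr_fun (d2.unique d1) a
  simpa using d3

/-- The derivative of the self-adjointness of $P$. -/
theorem inner_fderiv_projField (h : IsAdaptedFrame M U τ) {y : Euc N} (hy : y ∈ U)
    (a u v : Euc N) :
    inner ℝ (fderiv ℝ (projField τ) y a u) v = inner ℝ u (fderiv ℝ (projField τ) y a v) := by
  have d := h.hasFDerivAt_projField hy
  have d1 := (d.clm_apply (hasFDerivAt_const u y)).inner ℝ (hasFDerivAt_const v y)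
  have d2 := (hasFDerivAt_const u y).inner ℝ (d.clm_apply (hasFDerivAt_const v y))
  have d3 : (fun z => (inner ℝ (projField τ z u) v : ℝ)) =
      fun z => inner ℝ u (projField τ z v) := funext fun z => inner_frameProj _ u v
  rw [d3] at d1
  have d4 := DFunLike.congr_fun (d1.unique d2) a
  simpa using d4

theorem fderiv_projField_mem_orthogonal (h : IsAdaptedFrame M U τ) {y : Euc N} (hy : y ∈ U)
    (hyM : y ∈ M) (a : Euc N) {b : Euc N} (hb : b ∈ tangentSpace M y) :
    fderiv ℝ (projField τ) y a b ∈ (tangentSpace M y)ᗮ := by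
  have := h.fderiv_projField_split hy a b
  rw [h.projField_of_mem hy hyM hb, add_eq_right] at this
  exact (h.mem_orthogonal_iff hy hyM _).mpr this

theorem projField_fderiv_of_normal (h : IsAdaptedFrame M U τ) {y : Euc N} (hy : y ∈ U)
    (hyM : y ∈ M) (a : Euc N) {n : Euc N} (hn : n ∈ (tangentSpace M y)ᗮ) :
    projField τ y (fderiv ℝ (projField τ) y a n) = fderiv ℝ (projField τ) y a n := by
  have := h.fderiv_projField_split hy a n
  rwa [(h.mem_orthogonal_iff hy hyM _).mp hn, map_zero, add_zero] at this

theorem dirDeriv_proj (h : IsAdaptedFrame M U τ) {y : Euc N} (hy : y ∈ U) (hyM : y ∈ M)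
    {a : Euc N} (ha : a ∈ tangentSpace M y) (b : Euc N) :
    dirDeriv M (fun z => proj M z b) y a = fderiv ℝ (projField τ) y a b := by
  have d := (h.hasFDerivAt_projField hy).clm_apply (hasFDerivAt_const b y)
  rw [dirDeriv_eq hyM (h.mem_nhds hy) d (fun z hz hzM => (h.projField_eq_proj hz hzM b).symm) ha]
  simp

theorem secondFF_eq (h : IsAdaptedFrame M U τ) {y : Euc N} (hy : y ∈ U) (hyM : y ∈ M)
    {a b : Euc N} (ha : a ∈ tangentSpace M y) (hb : b ∈ tangentSpace M y) :
    secondFF M y a b = fderiv ℝ (projField τ) y a b := by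
  rw [secondFF, h.dirDeriv_proj hy hyM ha]
  exact Submodule.starProjection_eq_self_iff.mpr (h.fderiv_projField_mem_orthogonal hy hyM a hb)

theorem normSqB_eq (h : IsAdaptedFrame M U τ) {y : Euc N} (hy : y ∈ U) (hyM : y ∈ M) :
    normSqB M y = ∑ j, ∑ l, ‖fderiv ℝ (projField τ) y (tau M y l) (tau M y j)‖ ^ 2 := by
  refine Finset.sum_congr rfl fun j _ => Finset.sum_congr rfl fun l _ => ?_
  rw [h.secondFF_eq hy hyM (tau_mem M y l) (tau_mem M y j)]
  exact sum_inner_nu_sq (h.fderiv_projField_mem_orthogonal hy hyM _ (tau_mem M y j))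

end IsAdaptedFrame

end Local

/-! ### Traces over the tangent space, and the contracted Codazzi equation -/

section Trace

variable {κ F : Type*} [Fintype κ] [AddCommGroup F] [Module ℝ F] {t : κ → Euc N}
  {P : Euc N →L[ℝ] Euc N}

/-- The frame `tau` is chosen point by point, with no regularity in the point. Traces are therefore
differentiated as sums over the fixed standard basis, projected by $P$, and converted back to `tau`
only afterwards. -/
theorem sum_map_stdVec_proj (hP : P = frameProj t) (β : Euc N →ₗ[ℝ] Euc N →ₗ[ℝ] F)
    (R : Euc N →L[ℝ] Euc N) :
    ∑ i, β (R (stdVec N i)) (P (stdVec N i)) = ∑ j, β (R (t j)) (t j) :=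
  hP ▸ sum_stdVec_frameProj t (β ∘ₗ R.toLinearMap)

theorem sum_proj_map_stdVec (hP : P = frameProj t) (β : Euc N →ₗ[ℝ] Euc N →ₗ[ℝ] F)
    (R : Euc N →L[ℝ] Euc N) :
    ∑ i, β (P (stdVec N i)) (R (stdVec N i)) = ∑ j, β (t j) (R (t j)) :=
  sum_map_stdVec_proj hP β.flip R

theorem sum_proj_proj_stdVec (hP : P = frameProj t) (ht : ∀ j, P (t j) = t j)
    (β : Euc N →ₗ[ℝ] Euc N →ₗ[ℝ] F) :
    ∑ i, β (P (stdVec N i)) (P (stdVec N i)) = ∑ j, β (t j) (t j) := by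
  rw [sum_map_stdVec_proj hP β P]
  simp only [ht]

end Trace

/-- The bilinear map `(u, v) ↦ u ∧ A(v, c)`. -/
noncomputable def wedgeApply (A : Euc N →L[ℝ] Euc N →L[ℝ] Euc N) (c : Euc N) :
    Euc N →ₗ[ℝ] Euc N →ₗ[ℝ] GA N :=
  (wedgeVec N).compl₁₂ LinearMap.id (A.flip c).toLinearMap

/-- The Codazzi equation in contracted form: up to symmetric terms, which the exterior product
annihilates, the divergence of the shape bivector is the curl of the mean curvature vector. -/
theorem sum_wedge_codazzi {κ : Type*} [Fintype κ] {t : κ → Euc N}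
    {A : Euc N →L[ℝ] Euc N →L[ℝ] Euc N} {D : Euc N →L[ℝ] Euc N →L[ℝ] Euc N →L[ℝ] Euc N}
    (hD : ∀ u v, D u v = D v u) (hA : ∀ j k, A (t j) (t k) = A (t k) (t j))
    (hAA : ∀ i j k, frameProj t (A (t i) (A (t j) (t k))) = A (t i) (A (t j) (t k)))
    (hsa : ∀ a u v, inner ℝ (A a u) v = inner ℝ u (A a v)) :
    ∑ k, ∑ j, (wedgeVec N (A (t k) (t j)) (A (t j) (t k)) +
        wedgeVec N (t j) (D (t k) (t j) (t k) + A (A (t k) (t j)) (t k) +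
          A (t j) (A (t k) (t k)))) =
      ∑ j, wedgeVec N (t j) (∑ k, (D (t j) (t k) (t k) + A (A (t j) (t k)) (t k) +
        A (t k) (A (t j) (t k)))) := by
  have h0 : ∀ j k, wedgeVec N (A (t k) (t j)) (A (t j) (t k)) = 0 := fun j k => by
    rw [hA j k, wedgeVec_self]
  -- These vectors are tangent, and self-adjointness of `A (t i)` turns their coefficients into
  -- inner products of values of the second fundamental form. Their symmetry in `j, l`, after
  -- summing over `k` in `h2`, makes `h1` and `h2` vanish.
  have hexp : ∀ i j k, A (t i) (A (t j) (t k)) =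
      ∑ l, (inner ℝ (A (t i) (t l)) (A (t j) (t k)) : ℝ) • t l := fun i j k => by
    rw [← hAA, frameProj_apply]
    exact Finset.sum_congr rfl fun l _ => by rw [hsa]
  have h1 : ∀ k, ∑ j, wedgeVec N (t j) (A (t j) (A (t k) (t k))) = 0 := fun k => by
    simp only [hexp]
    exact sum_smul_wedgeVec_eq_zero t
      (fun j l => inner ℝ (A (t j) (t l)) (A (t k) (t k))) fun j l => by rw [hA]
  have h2 : ∑ j, wedgeVec N (t j) (∑ k, A (t k) (A (t j) (t k))) = 0 := by
    simp only [hexp]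
    have h3 : ∀ j, ∑ k, ∑ l, (inner ℝ (A (t k) (t l)) (A (t j) (t k)) : ℝ) • t l =
        ∑ l, (∑ k, inner ℝ (A (t k) (t l)) (A (t j) (t k)) : ℝ) • t l := fun j => by
      rw [Finset.sum_comm]
      simp only [Finset.sum_smul]
    simp only [h3]
    refine sum_smul_wedgeVec_eq_zero t
      (fun j l => ∑ k, inner ℝ (A (t k) (t l)) (A (t j) (t k))) fun j l => ?_
    refine Finset.sum_congr rfl fun k _ => ?_
    rw [real_inner_comm, hA j k, hA k l]
  simp only [h0, zero_add, Finset.sum_add_distrib, map_add, h1, h2, add_zero]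
  simp only [map_sum]
  rw [Finset.sum_comm]
  congr 1
  -- What remains agrees term by term, by the symmetry of the second derivative of $P$ and of the
  -- second fundamental form.
  · refine Finset.sum_congr rfl fun j _ => Finset.sum_congr rfl fun k _ => ?_
    rw [hD]
  · rw [Finset.sum_comm]
    refine Finset.sum_congr rfl fun j _ => Finset.sum_congr rfl fun k _ => ?_
    rw [hA]

/-- Every term with `k ≠ j` repeats a factor. This disposes of the tangential part of a
differentiated frame vector. -/
theorem blade_update_sum_smul {m : ℕ} (v : Fin m → Euc N) (j : Fin m) (c : Fin m → ℝ) :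
    blade (Function.update v j (∑ k, c k • v k)) = c j • blade v := by
  have h : bladeₐ N m (Function.update v j (∑ k, c k • v k)) =
      ∑ k, c k • bladeₐ N m (Function.update v j (v k)) := by
    rw [AlternatingMap.map_update_sum]
    exact Finset.sum_congr rfl fun k _ => AlternatingMap.map_update_smul _ _ _ _ _
  rw [← bladeₐ_apply, h, Finset.sum_eq_single j]
  · rw [Function.update_eq_self, bladeₐ_apply]
  · intro k _ hk
    rw [AlternatingMap.map_update_self _ _ hk.symm, smul_zero]
  · exact fun hj => absurd (Finset.mem_univ j) hj

/-! ### Shape bivector and the derivative of the Gauss map -/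

section Local

variable {m : ℕ} {M U : Set (Euc N)} {τ : Fin m → Euc N → Euc N}

/-- The shape bivector of a vector in terms of a local frame. -/
noncomputable def shapeL (τ : Fin m → Euc N → Euc N) (y : Euc N) : Euc N →L[ℝ] GA N :=
  ∑ i, (wedgeVecL N (projField τ y (stdVec N i))).comp
    (fderiv ℝ (projField τ) y (projField τ y (stdVec N i)))

theorem shapeL_apply (y a : Euc N) : shapeL τ y a = ∑ i, wedgeVec N (projField τ y (stdVec N i))
    (fderiv ℝ (projField τ) y (projField τ y (stdVec N i)) a) := by
  rw [shapeL, sum_apply]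
  rfl

theorem shapeL_eq_sum {κ : Type*} [Fintype κ] {t : κ → Euc N} {y : Euc N}
    (hP : projField τ y = frameProj t) (ht : ∀ j, projField τ y (t j) = t j) (a : Euc N) :
    shapeL τ y a = ∑ j, wedgeVec N (t j) (fderiv ℝ (projField τ) y (t j) a) := by
  rw [shapeL_apply]
  exact sum_proj_proj_stdVec hP ht (wedgeApply (fderiv ℝ (projField τ) y) a)

/-- The blade of a local frame. -/
noncomputable def frameBlade (τ : Fin m → Euc N → Euc N) (y : Euc N) : GA N :=
  blade fun j => τ j y

namespace IsAdaptedFrame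

theorem shapeL_eq_tau (h : IsAdaptedFrame M U τ) {y : Euc N} (hy : y ∈ U) (hyM : y ∈ M)
    (a : Euc N) : shapeL τ y a =
      ∑ j, wedgeVec N (tau M y j) (fderiv ℝ (projField τ) y (tau M y j) a) :=
  shapeL_eq_sum (h.projField_eq_frameProj_tau hy hyM)
    (fun j => h.projField_of_mem hy hyM (tau_mem M y j)) a

theorem shapeBiv_eq (h : IsAdaptedFrame M U τ) {y : Euc N} (hy : y ∈ U) (hyM : y ∈ M)
    (a : Euc N) : shapeBiv M y a = shapeL τ y a := by
  rw [h.shapeL_eq_tau hy hyM]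
  refine Finset.sum_congr rfl fun j _ => ?_
  rw [h.dirDeriv_proj hy hyM (tau_mem M y j)]
  rfl

theorem inner_tau_fderiv (h : IsAdaptedFrame M U τ) {y : Euc N} (hy : y ∈ U) (hyM : y ∈ M)
    {u : Euc N} (hu : u ∈ tangentSpace M y) (a : Euc N) {b : Euc N} (hb : b ∈ tangentSpace M y) :
    inner ℝ u (fderiv ℝ (projField τ) y a b) = 0 :=
  (Submodule.mem_orthogonal _ _).mp (h.fderiv_projField_mem_orthogonal hy hyM a hb) u hu

theorem shape_eq (h : IsAdaptedFrame M U τ) {y : Euc N} (hy : y ∈ U) (hyM : y ∈ M)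
    {a : Euc N} (ha : a ∈ tangentSpace M y) : shape M y a = shapeL τ y a := by
  rw [h.shapeL_eq_tau hy hyM]
  refine Finset.sum_congr rfl fun j _ => ?_
  rw [h.dirDeriv_proj hy hyM (tau_mem M y j),
    vec_mul_vec_of_inner_eq_zero (h.inner_tau_fderiv hy hyM (tau_mem M y j) _ ha)]

theorem hasFDerivAt_frame (h : IsAdaptedFrame M U τ) {y : Euc N} (hy : y ∈ U) (j : Fin m) :
    HasFDerivAt (τ j) (fderiv ℝ (τ j) y) y :=
  (((h.contDiffOn j).contDiffAt (h.mem_nhds hy)).differentiableAt (by simp)).hasFDerivAt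

/-- The derivative of $P\tau_j=\tau_j$. At points of $M$ it separates the normal part from the
tangential part. -/
theorem fderiv_frame (h : IsAdaptedFrame M U τ) {y : Euc N} (hy : y ∈ U) (j : Fin m)
    (a : Euc N) : fderiv ℝ (τ j) y a = fderiv ℝ (projField τ) y a (τ j y) +
      projField τ y (fderiv ℝ (τ j) y a) := by
  have d := h.hasFDerivAt_frame hy j
  have d1 := ((h.hasFDerivAt_projField hy).clm_apply d).congr_of_eventuallyEq (f₁ := τ j)
    (Filter.eventually_of_mem (h.mem_nhds hy) fun z hz => by
      classical
      change τ j z = frameProj (fun i => τ i z) (τ j z)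
      rw [frameProj_apply]
      simp [orthonormal_iff_ite.mp (h.orthonormal z hz)])
  have d2 := DFunLike.congr_fun (d.unique d1) a
  simp only [add_apply, ContinuousLinearMap.comp_apply, ContinuousLinearMap.flip_apply] at d2
  rw [add_comm]
  exact d2

theorem inner_frame_fderiv_frame (h : IsAdaptedFrame M U τ) {y : Euc N} (hy : y ∈ U)
    (j : Fin m) (a : Euc N) : (inner ℝ (τ j y) (fderiv ℝ (τ j) y a) : ℝ) = 0 := by
  have d := h.hasFDerivAt_frame hy j
  have d1 := (hasFDerivAt_const (𝕜 := ℝ) (1 : ℝ) y).congr_of_eventuallyEq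
    (f₁ := fun z => (inner ℝ (τ j z) (τ j z) : ℝ))
    (Filter.eventually_of_mem (h.mem_nhds hy) fun z hz => by
      simp only [real_inner_self_eq_norm_sq]
      rw [(h.orthonormal z hz).1 j, one_pow])
  have d2 := DFunLike.congr_fun ((d.inner ℝ d).unique d1) a
  simp [real_inner_comm] at d2
  exact d2

/-- The derivative of the Gauss map is the product with the negative shape bivector. -/
theorem exists_hasFDerivAt_frameBlade (h : IsAdaptedFrame M U τ) {y : Euc N} (hy : y ∈ U)
    (hyM : y ∈ M) : ∃ T' : Euc N →L[ℝ] GA N, HasFDerivAt (frameBlade τ) T' y ∧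
      ∀ a ∈ tangentSpace M y, T' a = -(shapeL τ y a * frameBlade τ y) := by
  obtain ⟨T', hT', hT'a⟩ := HasFDerivAt.blade (h.hasFDerivAt_frame hy)
  refine ⟨T', hT', fun a ha => ?_⟩
  have hon := h.orthonormal y hy
  rw [hT'a, shapeL_eq_sum (t := fun j => τ j y) rfl
    (fun j => h.projField_of_mem hy hyM (h.frame_mem hy hyM j)), Finset.sum_mul,
    ← Finset.sum_neg_distrib]
  refine Finset.sum_congr rfl fun j _ => ?_
  have hτ := h.frame_mem hy hyM
  -- The tangential part contributes only its $\tau_j$ component, which is zero because $\tau_j$ has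
  -- constant length.
  have hz : blade (Function.update (fun i => τ i y) j (projField τ y (fderiv ℝ (τ j) y a))) = 0 := by
    rw [projField, frameProj_apply, blade_update_sum_smul, h.inner_frame_fderiv_frame hy, zero_smul]
  have hadd : blade (Function.update (fun i => τ i y) j (fderiv ℝ (τ j) y a)) =
      blade (Function.update (fun i => τ i y) j (fderiv ℝ (projField τ) y a (τ j y))) +
        blade (Function.update (fun i => τ i y) j (projField τ y (fderiv ℝ (τ j) y a))) := by
    conv_lhs => rw [h.fderiv_frame hy]
    exact AlternatingMap.map_update_add (bladeₐ N m) _ _ _ _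
  have hnorm : ∀ i, inner ℝ (fderiv ℝ (projField τ) y a (τ j y)) (τ i y) = (0 : ℝ) := fun i => by
    rw [real_inner_comm]
    exact h.inner_tau_fderiv hy hyM (hτ i) a (hτ j)
  -- Symmetry turns $(D_aP)(\tau_j)$ into $(D_{\tau_j}P)(a)$, as in the shape bivector. Replacing
  -- $\tau_j$ by this normal vector $n$ is multiplication by $n\tau_j=-\tau_j n$, whence the minus
  -- sign.
  rw [hadd, hz, add_zero, h.fderiv_projField_symm hy hyM (hτ j) ha, ← vec_mul_vec_of_inner_eq_zero
    ((real_inner_comm _ _).trans (hnorm j)), vec_mul_vec_swap ((real_inner_comm _ _).trans (hnorm j)),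
    neg_mul, neg_neg, mul_assoc]
  exact (vec_mul_vec_mul_blade _ hon _ hnorm j).symm

theorem hasFDerivAt_fderiv_projField (h : IsAdaptedFrame M U τ) {y : Euc N} (hy : y ∈ U) :
    HasFDerivAt (fderiv ℝ (projField τ)) (fderiv ℝ (fderiv ℝ (projField τ)) y) y :=
  (((h.contDiffOn_projField.contDiffAt (h.mem_nhds hy)).fderiv_right (m := 1)
    (by norm_cast)).differentiableAt (by simp)).hasFDerivAt

theorem fderiv_fderiv_symm (h : IsAdaptedFrame M U τ) {y : Euc N} (hy : y ∈ U) (u v : Euc N) :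
    fderiv ℝ (fderiv ℝ (projField τ)) y u v = fderiv ℝ (fderiv ℝ (projField τ)) y v u :=
  ((h.contDiffOn_projField.contDiffAt (h.mem_nhds hy)).isSymmSndFDerivAt
    (by simp; norm_cast)).eq u v

/-- The derivative of `y ↦ P'_y(P_y u, P_y v)`. -/
theorem exists_hasFDerivAt_fderiv_projField_apply (h : IsAdaptedFrame M U τ) {y : Euc N}
    (hy : y ∈ U) (u v : Euc N) : ∃ B' : Euc N →L[ℝ] Euc N,
      HasFDerivAt (fun z => fderiv ℝ (projField τ) z (projField τ z u) (projField τ z v)) B' y ∧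
      ∀ a, B' a =
        fderiv ℝ (fderiv ℝ (projField τ)) y a (projField τ y u) (projField τ y v) +
        fderiv ℝ (projField τ) y (fderiv ℝ (projField τ) y a u) (projField τ y v) +
        fderiv ℝ (projField τ) y (projField τ y u) (fderiv ℝ (projField τ) y a v) := by
  have d := h.hasFDerivAt_projField hy
  have d2 := h.hasFDerivAt_fderiv_projField hy
  refine ⟨_, (d2.clm_apply (d.clm_apply (hasFDerivAt_const u y))).clm_apply
    (d.clm_apply (hasFDerivAt_const v y)), fun a => ?_⟩
  simp
  abel

theorem meanCurv_eq (h : IsAdaptedFrame M U τ) {y : Euc N} (hy : y ∈ U) (hyM : y ∈ M) :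
    meanCurv M y = ∑ i, fderiv ℝ (projField τ) y (projField τ y (stdVec N i))
      (projField τ y (stdVec N i)) := by
  refine Eq.trans (Finset.sum_congr rfl fun j _ =>
    h.secondFF_eq hy hyM (tau_mem M y j) (tau_mem M y j)) ?_
  exact (sum_proj_proj_stdVec (h.projField_eq_frameProj_tau hy hyM)
    (fun j => h.projField_of_mem hy hyM (tau_mem M y j))
    ((ContinuousLinearMap.coeLM ℝ) ∘ₗ (fderiv ℝ (projField τ) y).toLinearMap)).symm

theorem dirDeriv_meanCurv (h : IsAdaptedFrame M U τ) {y : Euc N} (hy : y ∈ U) (hyM : y ∈ M)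
    {a : Euc N} (ha : a ∈ tangentSpace M y) :
    dirDeriv M (meanCurv M) y a =
      ∑ k, (fderiv ℝ (fderiv ℝ (projField τ)) y a (tau M y k) (tau M y k) +
        fderiv ℝ (projField τ) y (fderiv ℝ (projField τ) y a (tau M y k)) (tau M y k) +
        fderiv ℝ (projField τ) y (tau M y k) (fderiv ℝ (projField τ) y a (tau M y k))) := by
  choose B' hB' hB'a using fun i => h.exists_hasFDerivAt_fderiv_projField_apply hy
    (stdVec N i) (stdVec N i)
  rw [dirDeriv_eq hyM (h.mem_nhds hy) (HasFDerivAt.fun_sum fun i _ => hB' i)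
    (fun z hz hzM => h.meanCurv_eq hz hzM) ha, sum_apply]
  simp only [hB'a, Finset.sum_add_distrib]
  have hP := h.projField_eq_frameProj_tau hy hyM
  have ht := fun j => h.projField_of_mem hy hyM (tau_mem M y j)
  congr 1
  · congr 1
    · exact sum_proj_proj_stdVec hP ht ((ContinuousLinearMap.coeLM ℝ) ∘ₗ
        (fderiv ℝ (fderiv ℝ (projField τ)) y a).toLinearMap)
    · exact sum_map_stdVec_proj hP ((ContinuousLinearMap.coeLM ℝ) ∘ₗ
        (fderiv ℝ (projField τ) y).toLinearMap) (fderiv ℝ (projField τ) y a)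
  · exact sum_proj_map_stdVec hP ((ContinuousLinearMap.coeLM ℝ) ∘ₗ
        (fderiv ℝ (projField τ) y).toLinearMap) (fderiv ℝ (projField τ) y a)

/-- The argument is a fixed ambient `v` projected at each point, so that it remains tangent along
$M$. Both $P$ and its derivative are then differentiated by the product rule. -/
theorem exists_hasFDerivAt_shapeL (h : IsAdaptedFrame M U τ) {y : Euc N} (hy : y ∈ U)
    (hyM : y ∈ M) (v : Euc N) : ∃ S' : Euc N →L[ℝ] GA N,
      HasFDerivAt (fun z => shapeL τ z (projField τ z v)) S' y ∧ ∀ a, S' a =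
        ∑ j, (wedgeVec N (fderiv ℝ (projField τ) y a (tau M y j))
            (fderiv ℝ (projField τ) y (tau M y j) (projField τ y v)) +
          wedgeVec N (tau M y j)
            (fderiv ℝ (fderiv ℝ (projField τ)) y a (tau M y j) (projField τ y v) +
              fderiv ℝ (projField τ) y (fderiv ℝ (projField τ) y a (tau M y j))
                (projField τ y v) +
              fderiv ℝ (projField τ) y (tau M y j) (fderiv ℝ (projField τ) y a v))) := by
  choose B' hB' hB'a using fun i => h.exists_hasFDerivAt_fderiv_projField_apply hy (stdVec N i) v
  have d := h.hasFDerivAt_projField hy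
  have hd : ∀ i, HasFDerivAt (fun z => wedgeVecL N (projField τ z (stdVec N i))
      (fderiv ℝ (projField τ) z (projField τ z (stdVec N i)) (projField τ z v))) _ y := fun i =>
    ((wedgeVecL N).hasFDerivAt.comp y (d.clm_apply (hasFDerivAt_const (stdVec N i) y))).clm_apply
      (hB' i)
  have hs : (fun z => shapeL τ z (projField τ z v)) = fun z =>
      ∑ i, wedgeVecL N (projField τ z (stdVec N i))
        (fderiv ℝ (projField τ) z (projField τ z (stdVec N i)) (projField τ z v)) :=
    funext fun z => shapeL_apply _ _
  rw [hs]
  refine ⟨_, HasFDerivAt.fun_sum fun i _ => hd i, fun a => ?_⟩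
  have hP := h.projField_eq_frameProj_tau hy hyM
  have ht := fun j => h.projField_of_mem hy hyM (tau_mem M y j)
  rw [sum_apply]
  simp only [add_apply, ContinuousLinearMap.comp_apply, ContinuousLinearMap.flip_apply,
    zero_apply, map_zero, zero_add, hB'a, wedgeVecL_apply, map_add, Finset.sum_add_distrib,
    Function.comp_apply]
  rw [add_comm]
  congr 1
  · exact sum_map_stdVec_proj hP (wedgeApply (fderiv ℝ (projField τ) y) (projField τ y v))
      (fderiv ℝ (projField τ) y a)
  · congr 1
    · congr 1
      · exact sum_proj_proj_stdVec hP ht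
          (wedgeApply (fderiv ℝ (fderiv ℝ (projField τ)) y a) (projField τ y v))
      · exact sum_proj_map_stdVec hP (wedgeApply (fderiv ℝ (projField τ) y) (projField τ y v))
          (fderiv ℝ (projField τ) y a)
    · exact sum_proj_proj_stdVec hP ht
        (wedgeApply (fderiv ℝ (projField τ) y) (fderiv ℝ (projField τ) y a v))

end IsAdaptedFrame

end Local

/-! ### Gradient and Laplacian of the logarithm -/

section Local

variable {m : ℕ} {M U : Set (Euc N)} {τ : Fin m → Euc N → Euc N}

/-- The linear form `v ↦ ⟨S_{P v} 𝔗, I⟩`. -/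
noncomputable def shapeForm (τ : Fin m → Euc N → Euc N) (I : GA N) (y : Euc N) :
    Euc N →L[ℝ] ℝ :=
  (ipL I).comp (((mulL N).flip (frameBlade τ y)).comp ((shapeL τ y).comp (projField τ y)))

theorem shapeForm_apply (I : GA N) (y v : Euc N) :
    shapeForm τ I y v = ip (shapeL τ y (projField τ y v) * frameBlade τ y) I := rfl

/-- The vector field that represents the logarithmic differential of `⟨𝔗, I⟩`. -/
noncomputable def logGrad (τ : Fin m → Euc N → Euc N) (I : GA N) (y : Euc N) : Euc N :=
  ∑ i, (-(shapeForm τ I y (stdVec N i) / ip (frameBlade τ y) I)) • stdVec N i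

theorem inner_logGrad (I : GA N) (y v : Euc N) :
    inner ℝ v (logGrad τ I y) = -(shapeForm τ I y v / ip (frameBlade τ y) I) := by
  have h := congrArg (shapeForm τ I y) (sum_inner_smul_stdVec v)
  simp only [map_sum, map_smul, smul_eq_mul] at h
  rw [logGrad, inner_sum, ← h, Finset.sum_div, ← Finset.sum_neg_distrib]
  refine Finset.sum_congr rfl fun i _ => ?_
  rw [inner_smul_right, real_inner_comm]
  ring

namespace IsAdaptedFrame

theorem contDiffOn_frameBlade (h : IsAdaptedFrame M U τ) : ContDiffOn ℝ ∞ (frameBlade τ) U :=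
  (bladeL N m).contDiff.comp_contDiffOn (contDiffOn_pi.mpr h.contDiffOn)

theorem exists_hasFDerivAt_ip (h : IsAdaptedFrame M U τ) {y : Euc N} (hy : y ∈ U) (hyM : y ∈ M)
    (I : GA N) : ∃ w' : Euc N →L[ℝ] ℝ, HasFDerivAt (fun z => ip (frameBlade τ z) I) w' y ∧
      ∀ a ∈ tangentSpace M y, w' a = -shapeForm τ I y a := by
  obtain ⟨T', hT', hT'a⟩ := h.exists_hasFDerivAt_frameBlade hy hyM
  refine ⟨_, (ipL I).hasFDerivAt.comp y hT', fun a ha => ?_⟩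
  rw [ContinuousLinearMap.comp_apply, hT'a a ha, map_neg, shapeForm_apply,
    h.projField_of_mem hy hyM ha, ipL_apply]

theorem grad_eq_logGrad (h : IsAdaptedFrame M U τ) {y : Euc N} (hy : y ∈ U) (hyM : y ∈ M)
    {I : GA N} {φ : Euc N → ℝ}
    (hφ : ∀ z ∈ U, z ∈ M → φ z = Real.log (ip (frameBlade τ z) I))
    (hne : ip (frameBlade τ y) I ≠ 0) : grad M φ y = logGrad τ I y := by
  obtain ⟨w', hw', hw'a⟩ := h.exists_hasFDerivAt_ip hy hyM I
  have hP := h.projField_eq_frameProj_tau hy hyM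
  have h1 : ∀ v, projField τ y (projField τ y v) = projField τ y v := fun v =>
    frameProj_frameProj (h.orthonormal y hy) v
  -- The linear form factors through $P$, so the vector representing it is tangent.
  have h2 : logGrad τ I y = projField τ y (logGrad τ I y) := by
    refine ext_inner_left ℝ fun v => ?_
    rw [projField, ← inner_frameProj]
    change _ = inner ℝ (projField τ y v) _
    rw [inner_logGrad, inner_logGrad, shapeForm_apply, shapeForm_apply, h1]
  rw [h2, hP, frameProj_apply]
  refine Finset.sum_congr rfl fun j _ => ?_
  rw [dirDeriv_eq hyM (h.mem_nhds hy) (hw'.log hne) hφ (tau_mem M y j), inner_logGrad,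
    smul_apply, hw'a _ (tau_mem M y j), smul_eq_mul]
  congr 1
  rw [div_eq_inv_mul, mul_neg]

/-- Where the derivative hits the shape bivector, the trace is the curl of the mean curvature. Where
it hits the blade, $D_a\mathfrak T=-\mathcal S_a\mathfrak T$ produces a second shape factor. -/
theorem exists_hasFDerivAt_shapeForm (h : IsAdaptedFrame M U τ) {y : Euc N} (hy : y ∈ U)
    (hyM : y ∈ M) (I : GA N) : ∃ K' : Euc N → Euc N →L[ℝ] ℝ,
      (∀ v, HasFDerivAt (fun z => shapeForm τ I z v) (K' v) y) ∧
      (curl M (meanCurv M) y = 0 → ∑ j, K' (tau M y j) (tau M y j) =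
        -∑ j, ip (shapeL τ y (tau M y j) * shapeL τ y (tau M y j) * frameBlade τ y) I) := by
  obtain ⟨T', hT', hT'a⟩ := h.exists_hasFDerivAt_frameBlade hy hyM
  choose S' hS' hS'a using h.exists_hasFDerivAt_shapeL hy hyM
  refine ⟨fun v => _, fun v => (ipL I).hasFDerivAt.comp y
    (((mulL N).hasFDerivAt.comp y (hS' v)).clm_apply hT'), fun hH => ?_⟩
  have ht := fun j => h.projField_of_mem hy hyM (tau_mem M y j)
  have hcod := sum_wedge_codazzi (t := tau M y) (h.fderiv_fderiv_symm hy)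
    (fun j k => h.fderiv_projField_symm hy hyM (tau_mem M y j) (tau_mem M y k))
    (fun i j k => by
      rw [← h.projField_eq_frameProj_tau hy hyM]
      exact h.projField_fderiv_of_normal hy hyM _
        (h.fderiv_projField_mem_orthogonal hy hyM _ (tau_mem M y k)))
    (h.inner_fderiv_projField hy)
  have hS0 : ∑ k, S' (tau M y k) (tau M y k) = 0 := by
    simp only [hS'a, ht]
    rw [hcod, ← hH]
    refine Finset.sum_congr rfl fun j _ => ?_
    rw [h.dirDeriv_meanCurv hy hyM (tau_mem M y j), wedgeVec_apply]
  have hval : ∀ j, ip (shapeL τ y (tau M y j) * T' (tau M y j)) I +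
      ip (S' (tau M y j) (tau M y j) * frameBlade τ y) I =
      ipL I (S' (tau M y j) (tau M y j) * frameBlade τ y) -
        ip (shapeL τ y (tau M y j) * shapeL τ y (tau M y j) * frameBlade τ y) I := fun j => by
    rw [hT'a _ (tau_mem M y j)]
    simp only [← ipL_apply]
    rw [mul_neg, map_neg, mul_assoc]
    ring
  simp only [add_apply, ContinuousLinearMap.comp_apply, ContinuousLinearMap.flip_apply, map_add,
    mulL_apply, ipL_apply, ht, Function.comp_apply]
  simp only [hval, Finset.sum_sub_distrib]
  rw [← map_sum, ← Finset.sum_mul, hS0, zero_mul, map_zero, zero_sub]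

theorem shapeL_sq (h : IsAdaptedFrame M U τ) {y : Euc N} (hy : y ∈ U) (hyM : y ∈ M) {a : Euc N}
    (ha : a ∈ tangentSpace M y) : shapeL τ y a * shapeL τ y a =
      wedge (shapeL τ y a) (shapeL τ y a) -
        algebraMap ℝ (GA N) (∑ l, ‖fderiv ℝ (projField τ) y (tau M y l) a‖ ^ 2) := by
  rw [h.shapeL_eq_tau hy hyM]
  exact sum_vec_mul_vec_sq _ _ (orthonormal_tau M y) fun j l =>
    h.inner_tau_fderiv hy hyM (tau_mem M y j) _ ha

/-- For tangent $a$ the contraction part of $\mathcal S(a)$ vanishes, so $\mathcal S(a)=\mathcal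
S_a$ and the wedge squares add up to `shapeWedge`. The scalar parts add up to $-|\mathrm B|^2$. -/
theorem sum_ip_shapeL_sq (h : IsAdaptedFrame M U τ) {y : Euc N} (hy : y ∈ U) (hyM : y ∈ M)
    (I : GA N) :
    ∑ j, ip (shapeL τ y (tau M y j) * shapeL τ y (tau M y j) * frameBlade τ y) I =
      ip (shapeWedge M y * frameBlade τ y) I - normSqB M y * ip (frameBlade τ y) I := by
  have h1 : shapeWedge M y =
      ∑ j, wedge (shapeL τ y (tau M y j)) (shapeL τ y (tau M y j)) :=
    Finset.sum_congr rfl fun j _ => by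
      rw [h.shape_eq hy hyM (tau_mem M y j), h.shapeBiv_eq hy hyM]
  have h2 : ∀ j, ip (shapeL τ y (tau M y j) * shapeL τ y (tau M y j) * frameBlade τ y) I =
      ip (wedge (shapeL τ y (tau M y j)) (shapeL τ y (tau M y j)) * frameBlade τ y) I -
      (∑ l, ‖fderiv ℝ (projField τ) y (tau M y l) (tau M y j)‖ ^ 2) * ip (frameBlade τ y) I :=
    fun j => by
      rw [h.shapeL_sq hy hyM (tau_mem M y j), sub_mul, ← Algebra.smul_def]
      simp only [← ipL_apply]
      rw [map_sub, map_smul, smul_eq_mul]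
  rw [h1, h.normSqB_eq hy hyM, Finset.sum_mul, Finset.sum_mul]
  simp only [h2, Finset.sum_sub_distrib]
  simp only [← ipL_apply, map_sum]

theorem neg_laplaceBeltrami_eq (h : IsAdaptedFrame M U τ) {y : Euc N} (hy : y ∈ U) (hyM : y ∈ M)
    {I : GA N} {φ : Euc N → ℝ}
    (hφ : ∀ z ∈ U, z ∈ M → φ z = Real.log (ip (frameBlade τ z) I))
    (hne : ∀ z ∈ U, z ∈ M → ip (frameBlade τ z) I ≠ 0)
    (hH : curl M (meanCurv M) y = 0) :
    -laplaceBeltrami M φ y = normSqB M y +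
      (‖derivTangent M y (fun a => ip (shapeBiv M y a * frameBlade τ y) I)‖ ^ 2 -
        ip (shapeWedge M y * frameBlade τ y) I * ip (frameBlade τ y) I) /
          ip (frameBlade τ y) I ^ 2 := by
  obtain ⟨w', hw', hw'a⟩ := h.exists_hasFDerivAt_ip hy hyM I
  obtain ⟨K', hK', hK'sum⟩ := h.exists_hasFDerivAt_shapeForm hy hyM I
  have hw0 := hne y hy hyM
  -- Quotient rule with `v` held fixed. Since $dw(a)=-\langle\mathcal S_a\mathfrak T,I\rangle$,
  -- setting `v` and the direction to $\tau_j$ gives the square in `hdir`.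
  have hq : ∀ v, HasFDerivAt (fun z => -(shapeForm τ I z v / ip (frameBlade τ z) I)) _ y :=
    fun v => (((hK' v).mul ((hasDerivAt_inv hw0).comp_hasFDerivAt y hw')).congr_of_eventuallyEq
      (Filter.Eventually.of_forall fun z => div_eq_mul_inv _ _)).neg
  obtain ⟨X', hX⟩ : ∃ X', HasFDerivAt (logGrad τ I) X' y :=
    ⟨_, HasFDerivAt.fun_sum fun i _ => (hq (stdVec N i)).smul_const (stdVec N i)⟩
  have hdir : ∀ j, inner ℝ (tau M y j) (dirDeriv M (grad M φ) y (tau M y j)) =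
      -(K' (tau M y j) (tau M y j) / ip (frameBlade τ y) I +
        shapeForm τ I y (tau M y j) ^ 2 / ip (frameBlade τ y) I ^ 2) := by
    intro j
    have ht := tau_mem M y j
    rw [dirDeriv_eq hyM (h.mem_nhds hy) hX
      (fun z hz hzM => h.grad_eq_logGrad hz hzM hφ (hne z hz hzM)) ht]
    have h1 := ((hasFDerivAt_const (tau M y j) y).inner ℝ hX)
    simp only [inner_logGrad] at h1
    have h2 := DFunLike.congr_fun (h1.unique (hq (tau M y j))) (tau M y j)
    simp [hw'a _ ht] at h2
    rw [h2]
    ring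
  have hnorm : ‖derivTangent M y (fun a => ip (shapeBiv M y a * frameBlade τ y) I)‖ ^ 2 =
      ∑ j, shapeForm τ I y (tau M y j) ^ 2 := by
    have h1 : derivTangent M y (fun a => ip (shapeBiv M y a * frameBlade τ y) I) =
        ∑ j, shapeForm τ I y (tau M y j) • tau M y j :=
      Finset.sum_congr rfl fun j _ => by
        beta_reduce
        rw [h.shapeBiv_eq hy hyM, shapeForm_apply, h.projField_of_mem hy hyM (tau_mem M y j)]
    rw [h1, ← real_inner_self_eq_norm_sq, (orthonormal_tau M y).inner_sum]
    exact Finset.sum_congr rfl fun j _ => (sq _).symm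
  rw [laplaceBeltrami, divergence, Finset.sum_congr rfl fun j _ => hdir j,
    Finset.sum_neg_distrib, neg_neg, Finset.sum_add_distrib, ← Finset.sum_div, ← Finset.sum_div,
    hK'sum hH, h.sum_ip_shapeL_sq hy hyM, hnorm]
  field_simp
  ring

theorem gaussMap_eq_or_neg (h : IsAdaptedFrame M U τ) {y : Euc N} (hy : y ∈ U) (hyM : y ∈ M)
    {T : Euc N → GA N} (hT : IsGaussMap m M T) :
    T y = frameBlade τ y ∨ T y = -frameBlade τ y := by
  obtain ⟨b, hb⟩ := hT.1 y hyM
  have hon := h.orthonormal y hy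
  let v : Fin m → tangentSpace M y := fun j => ⟨τ j y, h.frame_mem hy hyM j⟩
  have hv : Orthonormal ℝ v := by
    rw [orthonormal_iff_ite] at hon ⊢
    exact hon
  have hspan : ⊤ ≤ Submodule.span ℝ (Set.range v) := by
    rw [← Submodule.map_le_map_iff_of_injective (tangentSpace M y).injective_subtype,
      Submodule.map_span, ← Set.range_comp, Submodule.map_top, Submodule.range_subtype]
    exact (h.span_eq y hy hyM).ge
  have h1 := blade_orthonormalBasis_eq_or_neg b (OrthonormalBasis.mk hv hspan)
  rw [← hb, OrthonormalBasis.coe_mk] at h1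
  exact h1

/-- `Real.log` is even, so the local frame need not be matched to the orientation, even if the sign
varies over `U`. -/
theorem log_ip_gaussMap (h : IsAdaptedFrame M U τ) {T : Euc N → GA N} (hT : IsGaussMap m M T)
    (I : GA N) {y : Euc N} (hy : y ∈ U) (hyM : y ∈ M) :
    Real.log (ip (T y) I) = Real.log (ip (frameBlade τ y) I) := by
  rcases h.gaussMap_eq_or_neg hy hyM hT with h1 | h1
  · rw [h1]
  · rw [h1, ← ipL_apply, map_neg, Real.log_neg_eq_log, ipL_apply]

theorem ip_frameBlade_ne_zero (h : IsAdaptedFrame M U τ) {T : Euc N → GA N}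
    (hT : IsGaussMap m M T) {I : GA N} {y : Euc N} (hy : y ∈ U) (hyM : y ∈ M)
    (hpos : 0 < ip (T y) I) : ip (frameBlade τ y) I ≠ 0 := by
  rcases h.gaussMap_eq_or_neg hy hyM hT with h1 | h1
  · rw [← h1]
    exact hpos.ne'
  · rw [h1, ← ipL_apply, map_neg, ipL_apply, neg_pos] at hpos
    exact hpos.ne

end IsAdaptedFrame

end Local

end GeomCalc

/-! ### From the local frame to the Gauss map -/

theorem mainTheorem6 (N m : ℕ) (M : Set (GeomCalc.Euc N)) (T : GeomCalc.Euc N → GeomCalc.GA N)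
    (hM : GeomCalc.IsSmoothSubmanifold m M)
    (hT : GeomCalc.IsGaussMap m M T)
    (hH : ∀ x ∈ M, GeomCalc.curl M (GeomCalc.meanCurv M) x = 0)
    (I : GeomCalc.GA N) (hI : I ∈ GeomCalc.unitBlades N m)
    (hpos : ∀ x ∈ M, 0 < GeomCalc.ip (T x) I) :
    ContDiffOn ℝ ∞ (fun y => Real.log (GeomCalc.ip (T y) I)) M ∧
    ∀ x ∈ M,
      -GeomCalc.laplaceBeltrami M (fun y => Real.log (GeomCalc.ip (T y) I)) x =
        GeomCalc.normSqB M x +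
          (‖GeomCalc.derivTangent M x
              (fun a => GeomCalc.ip (GeomCalc.shapeBiv M x a * T x) I)‖ ^ 2 -
            GeomCalc.ip (GeomCalc.shapeWedge M x * T x) I * GeomCalc.ip (T x) I) /
          GeomCalc.ip (T x) I ^ 2 := by
  refine ⟨fun x hx => ?_, fun x hx => ?_⟩
  · obtain ⟨U, τ, hxU, h⟩ := hM.exists_adaptedFrame hx
    have h1 : ContDiffAt ℝ ∞ (fun y => GeomCalc.ip (GeomCalc.frameBlade τ y) I) x := by
      open scoped GeomCalc in
      exact (GeomCalc.ipL I).contDiff.contDiffAt.comp x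
        (h.contDiffOn_frameBlade.contDiffAt (h.mem_nhds hxU))
    refine ((h1.log (h.ip_frameBlade_ne_zero hT hxU hx
      (hpos x hx))).contDiffWithinAt (s := M)).congr_of_eventuallyEq ?_
      (h.log_ip_gaussMap hT I hxU hx)
    filter_upwards [mem_nhdsWithin_of_mem_nhds (h.mem_nhds hxU), self_mem_nhdsWithin] with y hy hyM
    exact h.log_ip_gaussMap hT I hy hyM
  · obtain ⟨U, τ, hxU, h⟩ := hM.exists_adaptedFrame hx
    have key := h.neg_laplaceBeltrami_eq hxU hx (fun z hz hzM => h.log_ip_gaussMap hT I hz hzM)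
      (fun z hz hzM => h.ip_frameBlade_ne_zero hT hz hzM (hpos z hzM)) (hH x hx)
    rw [key]
    -- The formula is quadratic in the blade in both numerator and denominator, hence unaffected by
    -- its sign.
    rcases h.gaussMap_eq_or_neg hxU hx hT with h1 | h1
    · rw [h1]
    · have hneg : ∀ A : GeomCalc.GA N, GeomCalc.ip (-A) I = -GeomCalc.ip A I := fun A => by
        rw [← neg_one_smul ℝ A, ← GeomCalc.ipL_apply, map_smul, GeomCalc.ipL_apply, neg_one_smul]
      have hd : GeomCalc.derivTangent M x
          (fun a => -GeomCalc.ip (GeomCalc.shapeBiv M x a * GeomCalc.frameBlade τ x) I) =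
          -GeomCalc.derivTangent M x
            (fun a => GeomCalc.ip (GeomCalc.shapeBiv M x a * GeomCalc.frameBlade τ x) I) := by
        simp only [GeomCalc.derivTangent, neg_smul, Finset.sum_neg_distrib]
      simp only [h1, mul_neg, hneg, hd, norm_neg, neg_sq, neg_mul, neg_neg]
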